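/- **Theorem 4.1 (Gradient flows, De Giorgi principle).** Let $H$ be a real separable Hilbert space with scalar product $(\cdot,\cdot)$ and norm $\|\cdot\|$, and let $T>0$. Let $\phi=\phi_1+\phi_2:H\to(-\infty,\infty]$, where $\phi_1:H\to(-\infty,\infty]$ is proper, convex and lower semicontinuous, its convex subdifferential $\partial\phi_1(y)$ contains at most one element for every $y\in H$, and $\phi_2:H\to\mathbb R$ is of class $C^{1,1}$ (continuously differentiable with locally Lipschitz differential). Set $D(\phi)=\{\phi<\infty\}$ and let $\partial\phi$ be the Fréchet subdifferential, $$\xi\in\partial\phi(y)\iff y\in D(\phi)\ \text{ and }\ \liminf_{w\to y}\frac{\phi(w)-\phi(y)-(\xi,w-y)}{\|w-y\|}\ge 0,$$ with $D(\partial\phi)=\{y:\partial\phi(y)\neq\emptyset\}$. (Under these assumptions $\partial\phi(y)$ has at most one element, which is again denoted by $\partial\phi(y)$.) Assume that all sublevels $\{\phi\le c\}$, $c\in\mathbb R$, are compact and that $\phi$ satisfies the chain rule: if $y\in H^1(0,T;H)$, $\xi\in L^2(0,T;H)$ and $\xi\in\partial\phi(y)$ a.e. in $(0,T)$, then $\phi\circ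 y$ is finite and absolutely continuous on $[0,T]$ and $(\phi\circ y)'=(\xi,y')$ a.e. in $(0,T)$. Let $y_0\in D(\phi)$, let $U\subset L^2(0,T;H)$ be nonempty and compact, let $\tau$ be the strong $\times$ weak topology of $X=L^2(0,T;H)\times H^1(0,T;H)$, and let $F:X\to[0,\infty]$ be (sequentially) lower semicontinuous with respect to $\tau$, with $F(u,y)<\infty$ only if $u\in U$. Define $G_{\rm DG}$ on $X$ by $$G_{\rm DG}(u,y)=\int_0^T\Big(\tfrac12\|y'\|^2+\tfrac12\|\partial\phi(y)-u\|^2-(u,y')\Big)\,dt+\phi(y(T))-\phi(y_0)$$ if $y\in D(\partial\phi)$ a.e. in $(0,T)$ and $y(0)=y_0$, and $G_{\rm DG}(u,y)=\infty$ otherwise. For $\varepsilon>0$ let $E_\varepsilon=F+\varepsilon^{-1}G_{\rm DG}$, and let $E_0=F$ on $\{G_{\rm DG}=0\}$ and $E_0=\infty$ elsewhere. Then $G_{\rm DG}$ takes values in $[0,\infty]$, and: 1. For every $\varepsilon>0$, $E_\varepsilon$ admits a minimizer on $X$. 2. $E_\varepsilon$ $\Gamma$-converges to $E_0$ with respect to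 $\tau$ as $\varepsilon\to0$: for every sequence $0<\varepsilon_n\to0$, one has $E_0(x)\le\liminf_n E_{\varepsilon_n}(x_n)$ whenever $x_n\to x$ in $\tau$, and for every $\hat x\in X$ there are $\hat x_n\to\hat x$ in $\tau$ with $E_{\varepsilon_n}(\hat x_n)\to E_0(\hat x)$. 3. Let $0<\varepsilon_n\to0$ and let $x_n\in X$ satisfy $\liminf_n\,(E_{\varepsilon_n}(x_n)-\inf_X E_{\varepsilon_n})=0$ (where the $E_{\varepsilon}$ are not identically $\infty$). Then a subsequence of $(x_n)$ $\tau$-converges to a minimizer of $E_0$. 4. If $E_0$ has a unique minimizer $x_0$, then for every $0<\varepsilon_n\to0$, every sequence $x_n\in X$ with $\lim_n\,(E_{\varepsilon_n}(x_n)-\inf_X E_{\varepsilon_n})=0$ (where the $E_{\varepsilon}$ are not identically $\infty$) $\tau$-converges to $x_0$. -/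

import Mathlib

open MeasureTheory Filter Topology Set

noncomputable section

namespace DeGiorgi

/-! ### Bochner and Sobolev spaces on `(0, T)` -/

section Spaces

variable (T : ℝ) (H : Type*) [NormedAddCommGroup H]

/-- The Bochner space `L²(0,T;H)`. -/
abbrev L2 : Type _ := Lp H 2 (volume.restrict (Ioo (0 : ℝ) T))

variable {T H} in
theorem L2.intervalIntegrable (v : L2 T H) {t : ℝ} (ht : t ∈ Ioo (0 : ℝ) T) :
    IntervalIntegrable v volume 0 t := by
  have h1 : Integrable v (volume.restrict (Ioo (0 : ℝ) T)) :=
    (Lp.memLp v).integrable (by norm_num)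
  rw [intervalIntegrable_iff_integrableOn_Ioc_of_le ht.1.le]
  exact IntegrableOn.mono_set h1 (fun s hs => ⟨hs.1, hs.2.trans_lt ht.2⟩)

variable [InnerProductSpace ℝ H]

/-- The Sobolev space `H¹(0,T;H)`: the pairs `(y, y')` in `L²(0,T;H)²` such that `y` agrees a.e.
with a primitive `t ↦ c + ∫₀ᵗ y'` of `y'`. As a subspace of the Hilbert product it carries the
norm `(‖y‖² + ‖y'‖²)^{1/2}`. -/
def H1Submodule : Submodule ℝ (WithLp 2 (L2 T H × L2 T H)) where
  carrier := {p | ∃ c : H, ∀ᵐ t ∂(volume.restrict (Ioo (0 : ℝ) T)),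
    p.fst t = c + ∫ s in (0 : ℝ)..t, p.snd s}
  zero_mem' := by
    refine ⟨0, ?_⟩
    have h := Lp.coeFn_zero H 2 (volume.restrict (Ioo (0 : ℝ) T))
    filter_upwards [h, ae_restrict_mem measurableSet_Ioo] with t ht htm
    have h0 : ∫ s in (0 : ℝ)..t, (0 : L2 T H) s = 0 := by
      rw [intervalIntegral.integral_of_le htm.1.le]
      have h' : ∀ᵐ s ∂(volume.restrict (Ioc (0 : ℝ) t)), (0 : L2 T H) s = 0 :=
        ae_restrict_of_ae_restrict_of_subset
          (fun s hs => (⟨hs.1, hs.2.trans_lt htm.2⟩ : s ∈ Ioo (0 : ℝ) T)) h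
      exact integral_eq_zero_of_ae h'
    simp only [WithLp.zero_fst, WithLp.zero_snd, h0, add_zero]
    exact ht
  add_mem' := by
    rintro p q ⟨c, hc⟩ ⟨d, hd⟩
    refine ⟨c + d, ?_⟩
    have h2 := Lp.coeFn_add p.snd q.snd
    filter_upwards [hc, hd, Lp.coeFn_add p.fst q.fst, ae_restrict_mem measurableSet_Ioo]
      with t h3 h4 h5 htm
    have h0 : ∫ s in (0 : ℝ)..t, (p.snd + q.snd : L2 T H) s =
        (∫ s in (0 : ℝ)..t, p.snd s) + ∫ s in (0 : ℝ)..t, q.snd s := by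
      rw [← intervalIntegral.integral_add (p.snd.intervalIntegrable htm)
        (q.snd.intervalIntegrable htm), intervalIntegral.integral_of_le htm.1.le,
        intervalIntegral.integral_of_le htm.1.le]
      exact integral_congr_ae (ae_restrict_of_ae_restrict_of_subset
          (fun s hs => (⟨hs.1, hs.2.trans_lt htm.2⟩ : s ∈ Ioo (0 : ℝ) T)) h2)
    simp only [WithLp.add_fst, WithLp.add_snd, h0]
    rw [h5, Pi.add_apply, h3, h4]
    abel
  smul_mem' := by
    rintro a p ⟨c, hc⟩
    refine ⟨a • c, ?_⟩
    have h2 := Lp.coeFn_smul a p.snd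
    filter_upwards [hc, Lp.coeFn_smul a p.fst, ae_restrict_mem measurableSet_Ioo]
      with t h3 h5 htm
    have h0 : ∫ s in (0 : ℝ)..t, (a • p.snd : L2 T H) s = a • ∫ s in (0 : ℝ)..t, p.snd s := by
      rw [← intervalIntegral.integral_smul, intervalIntegral.integral_of_le htm.1.le,
        intervalIntegral.integral_of_le htm.1.le]
      exact integral_congr_ae (ae_restrict_of_ae_restrict_of_subset
          (fun s hs => (⟨hs.1, hs.2.trans_lt htm.2⟩ : s ∈ Ioo (0 : ℝ) T)) h2)
    simp only [WithLp.smul_fst, WithLp.smul_snd, h0]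
    rw [h5, Pi.smul_apply, h3, smul_add]

/-- The Sobolev space `H¹(0,T;H)` as a (Hilbert) space. -/
abbrev H1 : Type _ := H1Submodule T H

variable {T H}

/-- The time derivative `y' ∈ L²(0,T;H)` of `y ∈ H¹(0,T;H)`. -/
def H1.deriv (y : H1 T H) : L2 T H := y.1.snd

/-- The value at `t ∈ [0,T]` of the continuous representative of `y ∈ H¹(0,T;H)`; for `T > 0`
the constant `c` is unique and equals `y(0)`. -/
def H1.eval (y : H1 T H) (t : ℝ) : H :=
  Classical.choose y.2 + ∫ s in (0 : ℝ)..t, y.deriv s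

variable (T H)

/-- `L²(0,T;H) × H¹(0,T;H)` with the strong × weak topology. -/
abbrev PhaseSpace : Type _ := L2 T H × WeakSpace ℝ (H1 T H)

end Spaces

/-! ### Potentials and subdifferentials -/

section Potentials

variable {H : Type*} [NormedAddCommGroup H] [InnerProductSpace ℝ H]

/-- `f : H → (-∞,∞]` is not identically `∞`. -/
def IsProper (f : H → EReal) : Prop := (∀ x, f x ≠ ⊥) ∧ ∃ x, f x ≠ ⊤

/-- Convexity of `f : H → (-∞,∞]`. -/
def IsConvex (f : H → EReal) : Prop :=
  ∀ x y : H, ∀ a b : ℝ, 0 ≤ a → 0 ≤ b → a + b = 1 →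
    f (a • x + b • y) ≤ (a : EReal) * f x + (b : EReal) * f y

/-- `C^{1,1}` regularity: continuously differentiable with locally Lipschitz differential. Functions
with globally Lipschitz differential are included. -/
def IsC11 (f : H → ℝ) : Prop := ContDiff ℝ 1 f ∧ LocallyLipschitz (fderiv ℝ f)

/-- The subdifferential of convex analysis. -/
def convexSubdiff (f : H → EReal) (y : H) : Set H :=
  {ξ | f y < ⊤ ∧ ∀ x, f y + ((inner ℝ ξ (x - y) : ℝ) : EReal) ≤ f x}

/-- The Fréchet subdifferential: `f y < ∞` and
`liminf_{w → y} (f w - f y - (ξ, w - y)) / ‖w - y‖ ≥ 0`, with the lower limit spelled out. -/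
def frechetSubdiff (f : H → EReal) (y : H) : Set H :=
  {ξ | f y < ⊤ ∧ ∀ η : ℝ, 0 < η → ∀ᶠ w in 𝓝 y,
    f y + ((inner ℝ ξ (w - y) - η * ‖w - y‖ : ℝ) : EReal) ≤ f w}

open Classical in
/-- The element of `∂f(y)`, meaningful where `∂f(y)` is a singleton (and `0` where it is empty). -/
def subgrad (f : H → EReal) (y : H) : H :=
  if h : (frechetSubdiff f y).Nonempty then h.some else 0

/-- The chain rule on `(0,T)`: if `y ∈ H¹(0,T;H)`, `ξ ∈ L²(0,T;H)` and `ξ ∈ ∂f(y)` a.e., then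
`f ∘ y` is (finite and) absolutely continuous and `(f ∘ y)' = (ξ, y')` a.e. -/
def ChainRule (T : ℝ) (f : H → EReal) : Prop :=
  ∀ (y : H1 T H) (ξ : L2 T H),
    (∀ᵐ t ∂(volume.restrict (Ioo (0 : ℝ) T)), ξ t ∈ frechetSubdiff f (y.eval t)) →
    (∀ t ∈ Icc (0 : ℝ) T, f (y.eval t) ≠ ⊤) ∧
    AbsolutelyContinuousOnInterval (fun t => (f (y.eval t)).toReal) 0 T ∧
    ∀ᵐ t ∂(volume.restrict (Ioo (0 : ℝ) T)),
      HasDerivAt (fun t => (f (y.eval t)).toReal) (inner ℝ (ξ t) (y.deriv t)) t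

open Classical in
/-- The De Giorgi functional
`∫₀ᵀ (½‖y'‖² + ½‖∂φ(y) - u‖² - (u,y')) dt + φ(y(T)) - φ(y₀)` if `y ∈ D(∂φ)` a.e. and `y(0) = y₀`,
and `∞` otherwise. The nonnegative part of the integrand, which need not be integrable, is
integrated in `[0,∞]`; `(u,y')` is integrable. -/
def GDG (T : ℝ) (φ : H → EReal) (y₀ : H) (u : L2 T H) (y : H1 T H) : EReal :=
  if (∀ᵐ t ∂(volume.restrict (Ioo (0 : ℝ) T)), (frechetSubdiff φ (y.eval t)).Nonempty) ∧
      y.eval 0 = y₀ then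
    ((∫⁻ t in Ioo (0 : ℝ) T,
        ENNReal.ofReal (1 / 2 * ‖y.deriv t‖ ^ 2 + 1 / 2 * ‖subgrad φ (y.eval t) - u t‖ ^ 2) :
          ENNReal) : EReal)
      - ((∫ t in Ioo (0 : ℝ) T, inner ℝ (u t) (y.deriv t) : ℝ) : EReal)
      + φ (y.eval T) - φ y₀
  else ⊤

/-- The De Giorgi functional on the space `L²(0,T;H) × H¹(0,T;H)` with strong × weak topology. -/
def constraint (T : ℝ) (φ : H → EReal) (y₀ : H) (x : PhaseSpace T H) : EReal :=
  GDG T φ y₀ x.1 ((toWeakSpace ℝ (H1 T H)).symm x.2)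

end Potentials

/-! ### Penalization and Γ-convergence -/

section Gamma

variable {X : Type*}

/-- The penalized functional `E_ε = F + ε⁻¹ G`. -/
def penalized (F : X → ENNReal) (G : X → EReal) (ε : ℝ) (x : X) : EReal :=
  (F x : EReal) + ((ε⁻¹ : ℝ) : EReal) * G x

open Classical in
/-- The limit functional: `E₀ = F` on `{G = 0}` and `E₀ = ∞` elsewhere. -/
def constrained (F : X → ENNReal) (G : X → EReal) (x : X) : EReal :=
  if G x = 0 then (F x : EReal) else ⊤

/-- `x` minimizes `E`. -/
def IsMinimizer (E : X → EReal) (x : X) : Prop := ∀ z, E x ≤ E z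

/-- `ε n > 0` and `ε n → 0`. -/
def IsVanishing (ε : ℕ → ℝ) : Prop := (∀ n, 0 < ε n) ∧ Tendsto ε atTop (𝓝 0)

/-- `x n` are quasiminimizers of `E (ε n)` in the weak sense
`liminf (E_ε(x_ε) - inf E_ε) = 0`. In `EReal` one has `∞ - ∞ = -∞`, so that this entails
`inf E_ε < ∞` infinitely often. -/
def IsLiminfQuasimin (E : ℝ → X → EReal) (ε : ℕ → ℝ) (x : ℕ → X) : Prop :=
  liminf (fun n => E (ε n) (x n) - ⨅ z, E (ε n) z) atTop = 0

/-- `x n` are quasiminimizers of `E (ε n)`: `lim (E_ε(x_ε) - inf E_ε) = 0`. -/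
def IsQuasimin (E : ℝ → X → EReal) (ε : ℕ → ℝ) (x : ℕ → X) : Prop :=
  Tendsto (fun n => E (ε n) (x n) - ⨅ z, E (ε n) z) atTop (𝓝 0)

variable [TopologicalSpace X]

/-- Lower semicontinuity along converging sequences (implied by `LowerSemicontinuous F`). -/
def SeqLowerSemicontinuous (F : X → ENNReal) : Prop :=
  ∀ (x : ℕ → X) (a : X), Tendsto x atTop (𝓝 a) → F a ≤ liminf (fun n => F (x n)) atTop

/-- `E_ε` Γ-converges to `E₀` as `ε → 0`: lower bound along every converging sequence,
and a recovery sequence for every point. -/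
def GammaConverges (E : ℝ → X → EReal) (E₀ : X → EReal) : Prop :=
  ∀ ε : ℕ → ℝ, IsVanishing ε →
    (∀ (x : ℕ → X) (a : X), Tendsto x atTop (𝓝 a) →
      E₀ a ≤ liminf (fun n => E (ε n) (x n)) atTop) ∧
    ∀ a : X, ∃ x : ℕ → X, Tendsto x atTop (𝓝 a) ∧
      Tendsto (fun n => E (ε n) (x n)) atTop (𝓝 (E₀ a))

end Gamma

end DeGiorgi

end

/-! Write `ξ` for the subgradient along `y`. The chain rule gives `φ(y(T)) - φ(y₀) = ∫ (ξ, y')`, and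
completing the square turns the De Giorgi functional into `½‖y' + ξ - u‖²` in `L²` wherever it is
finite. It is therefore nonnegative, and its zeros are the solutions of `y' + ξ = u`.

Coercivity comes from the original form: if `u` is bounded and the functional is at most `c`, then a
lower bound on `φ` controls `y'` and `ξ - u` in `L²` (`exists_bound`). Using the chain rule again up
to each time `t`, all values `y(t)` lie in one compact sublevel of `φ`. Weak convergence of `y'` and
the fixed initial value give weak convergence of `y(t)`, and compactness makes it strong, for every
`t`.

Pointwise strong convergence makes the functional lower semicontinuous (`constraint_lsc`). The slope
term is handled by Fatou's lemma and the strong-weak closedness of `∂φ`, which the sum rule `∂φ =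
∂φ₁ + ∇φ₂` inherits from the convex part; single-valuedness identifies the limit. The term `(u, y')`
is a strong-weak pairing, and `φ(y(T))` is lower semicontinuous. Sublevels over the compact set `U`
are sequentially compact (`constraint_compact`).

The rest is abstract penalization: a nonnegative constraint with closed sublevels, relatively
compact on the domain of `F` (`CoerciveConstraint`). Bounded energies force `G ≤ C ε → 0`, which
gives the lower bound; constant sequences are recovery sequences. Quasiminimizers are compared with
one of their own members, so compactness does not need a zero of `G`. -/

namespace DeGiorgi

/-! ### Weak convergence of sequences in Hilbert spaces. -/

section Weak

variable {E : Type*} [NormedAddCommGroup E] [InnerProductSpace ℝ E]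

/-- Weak convergence of a sequence in an inner product space. -/
def WeakConv (x : ℕ → E) (a : E) : Prop :=
  ∀ h : E, Tendsto (fun n => inner ℝ h (x n)) atTop (𝓝 (inner ℝ h a))

theorem Tendsto.weakConv {x : ℕ → E} {a : E} (hx : Tendsto x atTop (𝓝 a)) : WeakConv x a :=
  fun _ => tendsto_const_nhds.inner hx

theorem WeakConv.add {x y : ℕ → E} {a b : E} (hx : WeakConv x a) (hy : WeakConv y b) :
    WeakConv (fun n => x n + y n) (a + b) := fun h => by
  simpa only [inner_add_right] using (hx h).add (hy h)

theorem WeakConv.sub {x y : ℕ → E} {a b : E} (hx : WeakConv x a) (hy : WeakConv y b) :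
    WeakConv (fun n => x n - y n) (a - b) := fun h => by
  simpa only [inner_sub_right] using (hx h).sub (hy h)

theorem WeakConv.unique {x : ℕ → E} {a b : E} (ha : WeakConv x a) (hb : WeakConv x b) : a = b :=
  ext_inner_left ℝ fun h => tendsto_nhds_unique (ha h) (hb h)

/-- A bounded sequence in a separable Hilbert space has a weakly convergent subsequence. -/
theorem exists_weakConv_subseq [CompleteSpace E] [TopologicalSpace.SeparableSpace E]
    {x : ℕ → E} {R : ℝ} (hx : ∀ n, ‖x n‖ ≤ R) :
    ∃ (a : E) (k : ℕ → ℕ), StrictMono k ∧ WeakConv (fun n => x (k n)) a := by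
  -- Sequential Banach–Alaoglu, applied to the Riesz representatives.
  obtain ⟨f, -, k, hk, hf⟩ := WeakDual.isSeqCompact_closedBall ℝ E (0 : StrongDual ℝ E) R
    (x := fun n => StrongDual.toWeakDual (InnerProductSpace.toDual ℝ E (x n)))
    (fun n => by simpa using hx n)
  refine ⟨(InnerProductSpace.toDual ℝ E).symm (WeakDual.toStrongDual f), k, hk, fun h => ?_⟩
  have h1 := ((WeakDual.eval_continuous h).tendsto f).comp hf
  have h2 : inner ℝ h ((InnerProductSpace.toDual ℝ E).symm (WeakDual.toStrongDual f)) = f h := by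
    rw [real_inner_comm, InnerProductSpace.toDual_symm_apply]; rfl
  rw [h2]
  refine h1.congr fun n => ?_
  rw [real_inner_comm]; rfl

/-- The squared norm is weakly lower semicontinuous. -/
theorem WeakConv.eventually_lt_norm_sq {x : ℕ → E} {a : E} (hx : WeakConv x a) {r : ℝ}
    (hr : r < ‖a‖ ^ 2) : ∀ᶠ n in atTop, r < ‖x n‖ ^ 2 := by
  -- `2 (a, x n) - ‖a‖²` is a lower bound for `‖x n‖²` and tends to `‖a‖²`.
  have h := ((hx a).const_mul 2).sub_const (‖a‖ ^ 2)
  rw [real_inner_self_eq_norm_sq] at h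
  filter_upwards [h.eventually_const_lt (u := r) (by linarith)] with n hn
  have h1 := norm_sub_sq_real a (x n)
  nlinarith [sq_nonneg ‖a - x n‖]

theorem WeakConv.norm_le {x : ℕ → E} {a : E} (hx : WeakConv x a) {R : ℝ}
    (hR : ∀ n, ‖x n‖ ≤ R) : ‖a‖ ≤ R := by
  by_contra! h
  have h0 : 0 ≤ R := (norm_nonneg _).trans (hR 0)
  obtain ⟨n, hn⟩ := (hx.eventually_lt_norm_sq (r := R ^ 2) (by gcongr)).exists
  exact absurd hn (not_lt.2 (by have := hR n; gcongr))

/-- The scalar product is strong-weak continuous along bounded sequences. -/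
theorem WeakConv.tendsto_inner {u x : ℕ → E} {b a : E} (hu : Tendsto u atTop (𝓝 b))
    (hx : WeakConv x a) {R : ℝ} (hR : ∀ n, ‖x n‖ ≤ R) :
    Tendsto (fun n => inner ℝ (u n) (x n)) atTop (𝓝 (inner ℝ b a)) := by
  have h1 : Tendsto (fun n => inner ℝ (u n - b) (x n)) atTop (𝓝 0) := by
    refine squeeze_zero_norm (a := fun n => ‖u n - b‖ * R) (fun n => ?_) ?_
    · exact (norm_inner_le_norm _ _).trans (by have := hR n; gcongr)
    · simpa using (tendsto_iff_norm_sub_tendsto_zero.1 hu).mul_const R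
  simpa [inner_sub_left] using h1.add (hx b)

/-- Weak convergence inside a compact set is strong. -/
theorem WeakConv.tendsto_of_isCompact {x : ℕ → E} {a : E} (hx : WeakConv x a) {K : Set E}
    (hK : IsCompact K) (hxK : ∀ n, x n ∈ K) : Tendsto x atTop (𝓝 a) := by
  refine tendsto_of_subseq_tendsto fun ns hns => ?_
  obtain ⟨b, -, k, hk, hb⟩ := hK.tendsto_subseq (x := fun n => x (ns n)) (fun n => hxK _)
  refine ⟨k, ?_⟩
  have h1 : WeakConv (fun n => x (ns (k n))) a :=
    fun h => (hx h).comp (hns.comp hk.tendsto_atTop)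
  rwa [h1.unique (Tendsto.weakConv hb)]

end Weak

end DeGiorgi

/-! ### Subdifferentials: closedness and the sum rule. -/

namespace DeGiorgi

/-- In a separable metric space measurability can be tested on closed balls. -/
theorem measurable_of_closedBall {α Y : Type*} [MeasurableSpace α] [PseudoMetricSpace Y]
    [TopologicalSpace.SeparableSpace Y] [MeasurableSpace Y] [BorelSpace Y] {f : α → Y}
    (hf : ∀ (c : Y) (r : ℝ), 0 < r → MeasurableSet (f ⁻¹' Metric.closedBall c r)) :
    Measurable f := by
  refine measurable_of_isOpen fun V hV => ?_
  rcases isEmpty_or_nonempty Y with hY | hY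
  · rw [Set.eq_empty_of_isEmpty V]; simp
  let d := TopologicalSpace.denseSeq Y
  have hVu : V = ⋃ (p : ℕ × ℕ) (_ : Metric.closedBall (d p.1) (1 / ((p.2 : ℝ) + 1)) ⊆ V),
      Metric.closedBall (d p.1) (1 / ((p.2 : ℝ) + 1)) := by
    apply Subset.antisymm
    · intro z hz
      obtain ⟨δ, hδ, hball⟩ := Metric.isOpen_iff.1 hV z hz
      obtain ⟨m, hm⟩ := exists_nat_one_div_lt (half_pos hδ)
      have hpos : (0 : ℝ) < 1 / ((m : ℝ) + 1) := by positivity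
      obtain ⟨i, hi⟩ := (TopologicalSpace.denseRange_denseSeq Y).exists_dist_lt z hpos
      refine mem_iUnion₂.2 ⟨(i, m), fun w hw => hball ?_, ?_⟩
      · rw [Metric.mem_closedBall] at hw
        rw [Metric.mem_ball]
        have := dist_triangle w (d i) z
        rw [dist_comm] at hi
        change dist w (d i) ≤ _ at hw
        change dist (d i) z < _ at hi
        dsimp only at hw
        linarith
      · exact hi.le
    · exact iUnion₂_subset fun p hp => hp
  rw [hVu, preimage_iUnion₂]
  exact MeasurableSet.iUnion fun p => MeasurableSet.iUnion fun _ => hf _ _ (by positivity)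

section Subdiff

variable {H : Type*} [NormedAddCommGroup H] [InnerProductSpace ℝ H]

theorem exists_real_of_ne {x : EReal} (hb : x ≠ ⊥) (ht : x ≠ ⊤) : ∃ r : ℝ, x = r :=
  ⟨x.toReal, (EReal.coe_toReal ht hb).symm⟩

/-- The strong-weak closedness of the convex subdifferential. -/
theorem mem_convexSubdiff_of_weakConv {f : H → EReal} (hp : IsProper f)
    (hf : LowerSemicontinuous f) {y : ℕ → H} {a : H} (hy : Tendsto y atTop (𝓝 a))
    {ξ : ℕ → H} {ζ : H} (hξ : WeakConv ξ ζ) {R : ℝ} (hR : ∀ n, ‖ξ n‖ ≤ R)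
    (hmem : ∀ n, ξ n ∈ convexSubdiff f (y n)) : ζ ∈ convexSubdiff f a := by
  -- In `f (y n) ≤ r - (ξ n, x - y n)` the right side converges as a strong-weak pairing and the
  -- left side is lower semicontinuous. Any `x` with finite value also yields finiteness of `f a`.
  have key : ∀ x, ∀ r : ℝ, f x = r → ∃ s : ℝ, f a = s ∧ s + inner ℝ ζ (x - a) ≤ r := by
    intro x r hx
    have hin : Tendsto (fun n => inner ℝ (x - y n) (ξ n)) atTop (𝓝 (inner ℝ (x - a) ζ)) :=
      WeakConv.tendsto_inner (tendsto_const_nhds.sub hy) hξ hR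
    have hle : ∀ n, f (y n) ≤ ((r - inner ℝ (x - y n) (ξ n) : ℝ) : EReal) := by
      intro n
      have h := (hmem n).2 x
      obtain ⟨s, hs⟩ := exists_real_of_ne (hp.1 (y n)) (hmem n).1.ne
      rw [hx, hs] at h
      rw [hs]
      have h' : s + inner ℝ (ξ n) (x - y n) ≤ r := by exact_mod_cast h
      rw [real_inner_comm] at h'
      exact_mod_cast (by linarith : s ≤ r - inner ℝ (x - y n) (ξ n))
    have hfa : f a ≤ ((r - inner ℝ (x - a) ζ : ℝ) : EReal) := by
      by_contra! hlt
      obtain ⟨q, hq1, hq2⟩ := EReal.lt_iff_exists_real_btwn.1 hlt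
      have h1 := hy.eventually (hf a q hq2)
      have h2 : ∀ᶠ n in atTop, r - inner ℝ (x - y n) (ξ n) < q :=
        (tendsto_const_nhds.sub hin).eventually_lt_const (by exact_mod_cast hq1)
      obtain ⟨n, h3, h4⟩ := (h1.and h2).exists
      have h5 := h3.trans_le (hle n)
      exact absurd (EReal.coe_lt_coe_iff.1 h5) (not_lt.2 h4.le)
    obtain ⟨s, hs⟩ := exists_real_of_ne (hp.1 a) (hfa.trans_lt (EReal.coe_lt_top _)).ne
    refine ⟨s, hs, ?_⟩
    rw [hs] at hfa
    have := EReal.coe_le_coe_iff.1 hfa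
    rw [real_inner_comm]
    linarith
  obtain ⟨x₀, hx₀⟩ := hp.2
  obtain ⟨r₀, hr₀⟩ := exists_real_of_ne (hp.1 x₀) hx₀
  obtain ⟨s₀, hs₀, -⟩ := key x₀ r₀ hr₀
  refine ⟨hs₀ ▸ EReal.coe_lt_top _, fun x => ?_⟩
  by_cases hx : f x = ⊤
  · rw [hx]; exact le_top
  obtain ⟨r, hr⟩ := exists_real_of_ne (hp.1 x) hx
  obtain ⟨s, hs, hle⟩ := key x r hr
  rw [hs, hr]
  exact_mod_cast hle

theorem eventually_abs_sub_inner_gradient_le [CompleteSpace H] {f : H → ℝ} {y : H}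
    (hf : DifferentiableAt ℝ f y) {η : ℝ} (hη : 0 < η) :
    ∀ᶠ w in 𝓝 y, |f w - f y - inner ℝ (gradient f y) (w - y)| ≤ η * ‖w - y‖ := by
  have h := hf.hasGradientAt.hasFDerivAt.isLittleO.def hη
  filter_upwards [h] with w hw
  simpa using hw

/-- The sum rule: the Fréchet subdifferential of a `C¹` perturbation of a convex function. -/
theorem mem_frechetSubdiff_iff [CompleteSpace H] {φ φ₁ : H → EReal} {φ₂ : H → ℝ}
    (hφ : ∀ x, φ x = φ₁ x + (φ₂ x : EReal)) (hp : IsProper φ₁) (hc : IsConvex φ₁)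
    (hd : Differentiable ℝ φ₂) {y ξ : H} :
    ξ ∈ frechetSubdiff φ y ↔ ξ - gradient φ₂ y ∈ convexSubdiff φ₁ y := by
  have hfin : φ y < ⊤ ↔ φ₁ y < ⊤ := by
    rw [hφ, lt_top_iff_ne_top, lt_top_iff_ne_top]
    constructor
    · rintro h h'
      rw [h'] at h
      exact h (EReal.top_add_coe _)
    · intro h
      obtain ⟨s, hs⟩ := exists_real_of_ne (hp.1 y) h
      rw [hs, ← EReal.coe_add]
      exact EReal.coe_ne_top _
  constructor
  · rintro ⟨h1, h2⟩
    refine ⟨hfin.1 h1, fun x => ?_⟩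
    by_cases hx : φ₁ x = ⊤
    · rw [hx]; exact le_top
    obtain ⟨r, hr⟩ := exists_real_of_ne (hp.1 x) hx
    obtain ⟨s, hs⟩ := exists_real_of_ne (hp.1 y) (hfin.1 h1).ne
    rw [hr, hs, ← EReal.coe_add, EReal.coe_le_coe_iff]
    -- Along `y + t (x - y)` with small `t > 0`, convexity bounds `φ₁` from above, while the Fréchet
    -- inequality and the differentiability of `φ₂` each cost an error `η t ‖x - y‖`. Dividing by
    -- `t` makes the local inequality global.
    have key : ∀ η : ℝ, 0 < η →
        s + inner ℝ (ξ - gradient φ₂ y) (x - y) ≤ r + 2 * η * ‖x - y‖ := by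
      intro η hη
      have hcont : Tendsto (fun t : ℝ => y + t • (x - y)) (𝓝[>] 0) (𝓝 y) := by
        have : Continuous (fun t : ℝ => y + t • (x - y)) := by fun_prop
        simpa using (this.tendsto 0).mono_left nhdsWithin_le_nhds
      have hlt : ∀ᶠ t : ℝ in 𝓝[>] 0, t ∈ Ioo (0 : ℝ) 1 :=
        Ioo_mem_nhdsGT one_pos
      obtain ⟨t, ht1, ht2, ht0, ht3⟩ := ((hcont.eventually (h2 η hη)).and
        ((hcont.eventually (eventually_abs_sub_inner_gradient_le (hd y) hη)).and hlt)).exists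
      have hcv := hc y x (1 - t) t (by linarith) ht0.le (by ring)
      have hw : (1 - t) • y + t • x = y + t • (x - y) := by
        rw [sub_smul, smul_sub, one_smul]; abel
      rw [hw, hr, hs, ← EReal.coe_mul, ← EReal.coe_mul, ← EReal.coe_add] at hcv
      obtain ⟨q, hq⟩ := exists_real_of_ne (hp.1 (y + t • (x - y)))
        (hcv.trans_lt (EReal.coe_lt_top _)).ne
      rw [hφ, hφ, hq, hs, ← EReal.coe_add, ← EReal.coe_add, ← EReal.coe_add,
        EReal.coe_le_coe_iff] at ht1
      rw [hq, EReal.coe_le_coe_iff] at hcv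
      rw [add_sub_cancel_left, inner_smul_right, norm_smul, Real.norm_of_nonneg ht0.le] at ht1 ht2
      have ht2' := (abs_le.1 ht2).2
      rw [inner_sub_left]
      have : t * (s + (inner ℝ ξ (x - y) - inner ℝ (gradient φ₂ y) (x - y)))
          ≤ t * (r + 2 * η * ‖x - y‖) := by nlinarith
      exact le_of_mul_le_mul_left this ht0
    refine le_of_forall_pos_le_add fun δ hδ => ?_
    have h3 := key (δ / (2 * (‖x - y‖ + 1))) (by positivity)
    have h4 : 2 * (δ / (2 * (‖x - y‖ + 1))) * ‖x - y‖ ≤ δ := by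
      have h5 : 2 * (δ / (2 * (‖x - y‖ + 1))) * ‖x - y‖ = δ * (‖x - y‖ / (‖x - y‖ + 1)) := by
        field_simp
      rw [h5]
      have h6 : ‖x - y‖ / (‖x - y‖ + 1) ≤ 1 := by
        rw [div_le_one (by positivity)]; linarith
      nlinarith
    linarith
  · rintro ⟨h1, h2⟩
    refine ⟨hfin.2 h1, fun η hη => ?_⟩
    filter_upwards [eventually_abs_sub_inner_gradient_le (hd y) hη] with w hw
    obtain ⟨s, hs⟩ := exists_real_of_ne (hp.1 y) h1.ne
    rw [hφ, hφ]
    by_cases hx : φ₁ w = ⊤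
    · rw [hx, EReal.top_add_coe]; exact le_top
    obtain ⟨r, hr⟩ := exists_real_of_ne (hp.1 w) hx
    have h3 := h2 w
    rw [hs, hr, ← EReal.coe_add, EReal.coe_le_coe_iff, inner_sub_left] at h3
    rw [hs, hr, ← EReal.coe_add, ← EReal.coe_add, ← EReal.coe_add, EReal.coe_le_coe_iff]
    have := (abs_le.1 hw).1
    linarith

theorem subgrad_mem {f : H → EReal} {y : H} (h : (frechetSubdiff f y).Nonempty) :
    subgrad f y ∈ frechetSubdiff f y := by
  rw [subgrad, dif_pos h]
  exact h.some_mem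

/-- A potential whose Fréchet subdifferential is strong-weak closed along bounded sequences and
has at most one element at each point. -/
structure ClosedSingleSubdiff (φ : H → EReal) : Prop where
  subsingleton : ∀ y, (frechetSubdiff φ y).Subsingleton
  closed : ∀ (y : ℕ → H) (a : H), Tendsto y atTop (𝓝 a) → ∀ (ξ : ℕ → H) (ζ : H), WeakConv ξ ζ →
    ∀ R : ℝ, (∀ n, ‖ξ n‖ ≤ R) → (∀ n, ξ n ∈ frechetSubdiff φ (y n)) → ζ ∈ frechetSubdiff φ a

theorem continuous_gradient_of_contDiff [CompleteSpace H] {f : H → ℝ} (hf : ContDiff ℝ 1 f) :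
    Continuous (gradient f) :=
  (InnerProductSpace.toDual ℝ H).symm.continuous.comp (hf.continuous_fderiv one_ne_zero)

/-- The sum rule shifts `∂φ₁` by the continuous map `∇φ₂`, so both properties pass from the convex
subdifferential; along a convergent sequence the shift is bounded and converges strongly. -/
theorem closedSingleSubdiff [CompleteSpace H] {φ φ₁ : H → EReal} {φ₂ : H → ℝ}
    (hφ : ∀ x, φ x = φ₁ x + (φ₂ x : EReal)) (hp : IsProper φ₁) (hc : IsConvex φ₁)
    (hlsc : LowerSemicontinuous φ₁) (hsingle : ∀ y, (convexSubdiff φ₁ y).Subsingleton)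
    (hC : ContDiff ℝ 1 φ₂) : ClosedSingleSubdiff φ where
  subsingleton y ξ hξ ζ hζ := by
    have hd := hC.differentiable one_ne_zero
    have := hsingle y ((mem_frechetSubdiff_iff hφ hp hc hd).1 hξ)
      ((mem_frechetSubdiff_iff hφ hp hc hd).1 hζ)
    exact sub_left_injective this
  closed y a hy ξ ζ hξ R hR hmem := by
    have hd := hC.differentiable one_ne_zero
    have hg := ((continuous_gradient_of_contDiff hC).tendsto a).comp hy
    obtain ⟨M, hM⟩ := (Metric.isBounded_range_of_tendsto _ hg).exists_norm_le
    refine (mem_frechetSubdiff_iff hφ hp hc hd).2 (mem_convexSubdiff_of_weakConv hp hlsc hy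
      (hξ.sub (Tendsto.weakConv hg)) (R := R + M) (fun n => ?_)
      fun n => (mem_frechetSubdiff_iff hφ hp hc hd).1 (hmem n))
    exact (norm_sub_le _ _).trans (add_le_add (hR n) (hM _ (mem_range_self n)))

/-! ### Measurability and semicontinuity of the slope. -/

variable [CompleteSpace H] [TopologicalSpace.SeparableSpace H] {φ : H → EReal}

/-- Subgradients chosen in the ball have a weakly convergent subsequence; its limit stays in the
ball by weak semicontinuity of the norm, and in the subdifferential by closedness. -/
theorem ClosedSingleSubdiff.isClosed_inter_closedBall (hφ : ClosedSingleSubdiff φ) (c : H) (r : ℝ) :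
    IsClosed {y | (frechetSubdiff φ y ∩ Metric.closedBall c r).Nonempty} := by
  refine IsSeqClosed.isClosed fun y a hy hya => ?_
  choose ξ hξ hξc using hy
  have hb : ∀ n, ‖ξ n - c‖ ≤ r := fun n => by simpa [dist_eq_norm] using hξc n
  obtain ⟨ζ, k, hk, hζ⟩ := exists_weakConv_subseq hb
  have hζ' : WeakConv (fun n => ξ (k n)) (ζ + c) := by
    simpa using hζ.add (Tendsto.weakConv (tendsto_const_nhds (x := c)))
  refine ⟨ζ + c, hφ.closed _ a (hya.comp hk.tendsto_atTop) _ _ hζ' (r + ‖c‖) (fun n => ?_)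
    (fun n => hξ (k n)), ?_⟩
  · have := norm_add_le (ξ (k n) - c) c
    rw [sub_add_cancel] at this
    linarith [hb (k n)]
  · simpa [dist_eq_norm] using hζ.norm_le fun n => hb (k n)

/-- By single-valuedness, the preimage of a closed ball within the domain of `∂φ` is one of the
closed sets above. Off the domain the default value `0` adds either the whole complement or nothing.
-/
theorem ClosedSingleSubdiff.measurable_subgrad [MeasurableSpace H] [BorelSpace H]
    (hφ : ClosedSingleSubdiff φ) : Measurable (subgrad φ) := by
  have hD : MeasurableSet {y | (frechetSubdiff φ y).Nonempty} := by
    have : {y | (frechetSubdiff φ y).Nonempty} =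
        ⋃ n : ℕ, {y | (frechetSubdiff φ y ∩ Metric.closedBall 0 (n : ℝ)).Nonempty} := by
      ext y
      simp only [mem_ofPred_eq, mem_iUnion]
      constructor
      · rintro ⟨ξ, hξ⟩
        obtain ⟨n, hn⟩ := exists_nat_ge ‖ξ‖
        exact ⟨n, ξ, hξ, by simpa using hn⟩
      · rintro ⟨n, ξ, hξ, -⟩
        exact ⟨ξ, hξ⟩
    rw [this]
    exact MeasurableSet.iUnion fun n => (hφ.isClosed_inter_closedBall 0 n).measurableSet
  refine measurable_of_closedBall fun c r _ => ?_
  have : subgrad φ ⁻¹' Metric.closedBall c r =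
      {y | (frechetSubdiff φ y ∩ Metric.closedBall c r).Nonempty} ∪
        ({y | (frechetSubdiff φ y).Nonempty}ᶜ ∩ {_y | (0 : H) ∈ Metric.closedBall c r}) := by
    ext y
    by_cases hy : (frechetSubdiff φ y).Nonempty
    · simp only [mem_preimage, mem_union, mem_ofPred_eq, mem_inter_iff, mem_compl_iff, hy,
        not_true_eq_false, false_and, or_false]
      constructor
      · exact fun h => ⟨_, subgrad_mem hy, h⟩
      · rintro ⟨ξ, hξ, hξ'⟩
        rwa [hφ.subsingleton y (subgrad_mem hy) hξ]
    · have hy' : subgrad φ y = 0 := by rw [subgrad, dif_neg hy]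
      have hy'' : frechetSubdiff φ y = ∅ := not_nonempty_iff_eq_empty.1 hy
      simp only [mem_preimage, mem_union, mem_ofPred_eq, mem_inter_iff, mem_compl_iff, hy', hy'']
      simp
  rw [this]
  exact (hφ.isClosed_inter_closedBall c r).measurableSet.union
    (hD.compl.inter (MeasurableSet.const _))

/-- Pointwise lower semicontinuity of `(y, u) ↦ ‖∂φ(y) - u‖`. -/
theorem ClosedSingleSubdiff.norm_subgrad_sub_le (hφ : ClosedSingleSubdiff φ) {y : ℕ → H} {a : H}
    (hy : Tendsto y atTop (𝓝 a)) {u : ℕ → H} {b : H} (hu : Tendsto u atTop (𝓝 b))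
    (hD : ∀ n, (frechetSubdiff φ (y n)).Nonempty) {R : ℝ}
    (hR : ∃ᶠ n in atTop, ‖subgrad φ (y n) - u n‖ ≤ R) :
    (frechetSubdiff φ a).Nonempty ∧ ‖subgrad φ a - b‖ ≤ R := by
  obtain ⟨k, hk, hkR⟩ := extraction_of_frequently_atTop hR
  obtain ⟨ζ, l, hl, hζ⟩ := exists_weakConv_subseq hkR
  have hlim : Tendsto (fun n => k (l n)) atTop atTop := hk.tendsto_atTop.comp hl.tendsto_atTop
  obtain ⟨M, hM⟩ := (Metric.isBounded_range_of_tendsto _ hu).exists_norm_le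
  have hζ' : WeakConv (fun n => subgrad φ (y (k (l n)))) (ζ + b) := by
    simpa using hζ.add (Tendsto.weakConv (hu.comp hlim))
  have hmem : ζ + b ∈ frechetSubdiff φ a := by
    refine hφ.closed _ a (hy.comp hlim) _ _ hζ' (R + M) (fun n => ?_)
      (fun n => subgrad_mem (hD (k (l n))))
    have := norm_add_le (subgrad φ (y (k (l n))) - u (k (l n))) (u (k (l n)))
    rw [sub_add_cancel] at this
    linarith [hkR (l n), hM _ (mem_range_self (k (l n)))]
  refine ⟨⟨_, hmem⟩, ?_⟩
  rw [hφ.subsingleton a (subgrad_mem ⟨_, hmem⟩) hmem, add_sub_cancel_right]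
  exact hζ.norm_le fun n => hkR (l n)

end Subdiff

end DeGiorgi

noncomputable section

namespace DeGiorgi

/-! ### The space `H¹(0,T;H)` as initial values and derivatives. -/

section Sobolev

variable {T : ℝ} {H : Type*} [NormedAddCommGroup H]

theorem L2.integrable (v : L2 T H) : IntegrableOn v (Ioo (0 : ℝ) T) :=
  (Lp.memLp v).integrable (by norm_num)

theorem L2.integrableOn_Icc (v : L2 T H) : IntegrableOn v (Icc (0 : ℝ) T) :=
  (integrableOn_Icc_iff_integrableOn_Ioo).2 v.integrable

theorem L2.integral_norm_le (v : L2 T H) :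
    ∫ s in Ioo (0 : ℝ) T, ‖v s‖ ≤ ‖v‖ * √T := by
  rcases le_or_gt T 0 with hT | hT
  · rw [setIntegral_measure_zero _ (by simp [hT])]; positivity
  have h := eLpNorm_le_eLpNorm_mul_rpow_measure_univ (p := 1) (q := 2) (by norm_num)
    (Lp.aestronglyMeasurable v)
  have h1 : eLpNorm v 1 (volume.restrict (Ioo (0 : ℝ) T)) =
      ENNReal.ofReal (∫ s in Ioo (0 : ℝ) T, ‖v s‖) := by
    rw [eLpNorm_one_eq_lintegral_enorm, ofReal_integral_norm_eq_lintegral_enorm v.integrable]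
  have h2 : (volume.restrict (Ioo (0 : ℝ) T)) univ ^
      (1 / (1 : ENNReal).toReal - 1 / (2 : ENNReal).toReal) = ENNReal.ofReal (√T) := by
    rw [Measure.restrict_apply_univ, Real.volume_Ioo, sub_zero, Real.sqrt_eq_rpow,
      ← ENNReal.ofReal_rpow_of_pos hT]
    norm_num
  rw [h1, h2, ← ENNReal.ofReal_toReal (Lp.memLp v).2.ne, ← Lp.norm_def,
    ← ENNReal.ofReal_mul (norm_nonneg _)] at h
  exact (ENNReal.ofReal_le_ofReal_iff (by positivity)).1 h

variable [InnerProductSpace ℝ H]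

theorem L2.norm_intervalIntegral_le (v : L2 T H) {t : ℝ} (ht : t ∈ Icc (0 : ℝ) T) :
    ‖∫ s in (0 : ℝ)..t, v s‖ ≤ ‖v‖ * √T := by
  rw [intervalIntegral.integral_of_le ht.1]
  refine (norm_integral_le_integral_norm _).trans (le_trans ?_ v.integral_norm_le)
  rw [← integral_Icc_eq_integral_Ioo]
  exact setIntegral_mono_set v.integrableOn_Icc.norm (Eventually.of_forall fun _ => norm_nonneg _)
    (Eventually.of_forall fun s hs => ⟨hs.1.le, hs.2.trans ht.2⟩)

theorem L2.continuousOn_primitive (v : L2 T H) :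
    ContinuousOn (fun t => ∫ s in (0 : ℝ)..t, v s) (Icc 0 T) := by
  rcases le_or_gt 0 T with hT | hT
  · have := intervalIntegral.continuousOn_primitive_interval (a := 0) (b := T) (μ := volume)
      (f := v) (by rw [uIcc_of_le hT]; exact v.integrableOn_Icc)
    rwa [uIcc_of_le hT] at this
  · rw [Icc_eq_empty (not_le.2 hT)]; exact continuousOn_empty _

theorem L2.memLp_primitive (v : L2 T H) :
    MemLp (fun t => ∫ s in (0 : ℝ)..t, v s) 2 (volume.restrict (Ioo (0 : ℝ) T)) := by
  refine MemLp.of_bound ((v.continuousOn_primitive.mono Ioo_subset_Icc_self).aestronglyMeasurable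
    measurableSet_Ioo) (‖v‖ * √T) ?_
  filter_upwards [ae_restrict_mem measurableSet_Ioo] with t ht
  exact v.norm_intervalIntegral_le (Ioo_subset_Icc_self ht)

theorem ae_of_ae_Ioo {p : ℝ → Prop} (h : ∀ᵐ s ∂(volume.restrict (Ioo (0 : ℝ) T)), p s) {t : ℝ}
    (ht : t ∈ Icc (0 : ℝ) T) : ∀ᵐ s ∂(volume.restrict (Ioc (0 : ℝ) t)), p s := by
  rw [restrict_Ioo_eq_restrict_Ioc] at h
  exact ae_restrict_of_ae_restrict_of_subset (Ioc_subset_Ioc_right ht.2) h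

theorem intervalIntegral_congr_ae_Ioo {E : Type*} [NormedAddCommGroup E] [NormedSpace ℝ E]
    {f g : ℝ → E} (h : f =ᵐ[volume.restrict (Ioo (0 : ℝ) T)] g) {t : ℝ}
    (ht : t ∈ Icc (0 : ℝ) T) : ∫ s in (0 : ℝ)..t, f s = ∫ s in (0 : ℝ)..t, g s := by
  rw [intervalIntegral.integral_of_le ht.1, intervalIntegral.integral_of_le ht.1]
  exact integral_congr_ae (ae_of_ae_Ioo h ht)

/-- The primitive `v ↦ ∫₀ᵗ v` as a bounded operator on `L²(0,T;H)`. -/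
def primitiveL (T : ℝ) (H : Type*) [NormedAddCommGroup H] [InnerProductSpace ℝ H] :
    L2 T H →L[ℝ] L2 T H :=
  LinearMap.mkContinuous
    { toFun := fun v => v.memLp_primitive.toLp _
      map_add' := fun v w => by
        rw [← MemLp.toLp_add, MemLp.toLp_eq_toLp_iff]
        filter_upwards [ae_restrict_mem measurableSet_Ioo] with t ht
        have ht' := Ioo_subset_Icc_self ht
        rw [intervalIntegral_congr_ae_Ioo (Lp.coeFn_add v w) ht', Pi.add_apply,
          ← intervalIntegral.integral_add (v.intervalIntegrable ht) (w.intervalIntegrable ht)]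
        rfl
      map_smul' := fun a v => by
        rw [RingHom.id_apply, ← MemLp.toLp_const_smul, MemLp.toLp_eq_toLp_iff]
        filter_upwards [ae_restrict_mem measurableSet_Ioo] with t ht
        have ht' := Ioo_subset_Icc_self ht
        rw [intervalIntegral_congr_ae_Ioo (Lp.coeFn_smul a v) ht', Pi.smul_apply,
          ← intervalIntegral.integral_smul]
        rfl }
    (((measureUnivNNReal (volume.restrict (Ioo (0 : ℝ) T)) : NNReal) : ℝ) ^ (2 : ENNReal).toReal⁻¹
      * √T)
    (fun v => by
      refine (Lp.norm_le_of_ae_bound (C := ‖v‖ * √T) (by positivity) ?_).trans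
        (le_of_eq (by ring))
      filter_upwards [v.memLp_primitive.coeFn_toLp, ae_restrict_mem measurableSet_Ioo] with t h1 ht
      rw [LinearMap.coe_mk, AddHom.coe_mk, h1]
      exact v.norm_intervalIntegral_le (Ioo_subset_Icc_self ht))

theorem primitiveL_ae (v : L2 T H) : primitiveL T H v =ᵐ[volume.restrict (Ioo (0 : ℝ) T)]
    fun t => ∫ s in (0 : ℝ)..t, v s :=
  v.memLp_primitive.coeFn_toLp

/-- The element of `H¹(0,T;H)` with given initial value and derivative. -/
def H1.mkL (T : ℝ) (H : Type*) [NormedAddCommGroup H] [InnerProductSpace ℝ H] :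
    H × L2 T H →L[ℝ] H1 T H :=
  ContinuousLinearMap.codRestrict
    ((WithLp.prodContinuousLinearEquiv 2 ℝ (L2 T H) (L2 T H)).symm.toContinuousLinearMap ∘L
      ((Lp.constL 2 (volume.restrict (Ioo (0 : ℝ) T)) ℝ ∘L ContinuousLinearMap.fst ℝ H (L2 T H) +
        primitiveL T H ∘L ContinuousLinearMap.snd ℝ H (L2 T H)).prod
          (ContinuousLinearMap.snd ℝ H (L2 T H)))) (H1Submodule T H) (fun p => by
    refine ⟨p.1, ?_⟩
    change ∀ᵐ t ∂(volume.restrict (Ioo (0 : ℝ) T)),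
      (Lp.constL 2 (volume.restrict (Ioo (0 : ℝ) T)) ℝ p.1 + primitiveL T H p.2 : L2 T H) t =
        p.1 + ∫ s in (0 : ℝ)..t, p.2 s
    filter_upwards [Lp.coeFn_add (Lp.constL 2 (volume.restrict (Ioo (0 : ℝ) T)) ℝ p.1)
      (primitiveL T H p.2), primitiveL_ae p.2,
      Lp.coeFn_const (p := 2) (μ := volume.restrict (Ioo (0 : ℝ) T)) p.1] with t h1 h2 h3
    rw [h1, Pi.add_apply, h2]
    congr 1)

theorem H1.fst_ae (y : H1 T H) : ∀ᵐ t ∂(volume.restrict (Ioo (0 : ℝ) T)), y.1.fst t = y.eval t :=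
  Classical.choose_spec y.2

/-- The interval has positive measure, so two representations share a time at which both hold, which
forces equal constants. This makes `eval` independent of the choice in its definition. -/
theorem H1.eval_eq_of_ae (hT : 0 < T) (y : H1 T H) {c : H}
    (hc : ∀ᵐ t ∂(volume.restrict (Ioo (0 : ℝ) T)),
      y.1.fst t = c + ∫ s in (0 : ℝ)..t, y.deriv s) (t : ℝ) :
    y.eval t = c + ∫ s in (0 : ℝ)..t, y.deriv s := by
  have hne : (ae (volume.restrict (Ioo (0 : ℝ) T))).NeBot := by
    rw [ae_neBot, Ne, Measure.restrict_eq_zero, Real.volume_Ioo]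
    simpa using hT
  obtain ⟨s, h1, h2⟩ := (hc.and y.fst_ae).exists
  have : c = Classical.choose y.2 := by
    rw [h1, H1.eval] at h2
    exact add_right_cancel h2
  rw [H1.eval, this]

theorem H1.eval_zero (y : H1 T H) : y.eval 0 = Classical.choose y.2 := by
  simp [H1.eval]

theorem H1.eval_eq (y : H1 T H) (t : ℝ) :
    y.eval t = y.eval 0 + ∫ s in (0 : ℝ)..t, y.deriv s := by
  rw [H1.eval_zero]; rfl

theorem H1.eval_mkL (hT : 0 < T) (c : H) (v : L2 T H) (t : ℝ) :
    (H1.mkL T H (c, v)).eval t = c + ∫ s in (0 : ℝ)..t, v s := by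
  refine H1.eval_eq_of_ae hT _ ?_ t
  change ∀ᵐ t ∂(volume.restrict (Ioo (0 : ℝ) T)),
      (Lp.constL 2 (volume.restrict (Ioo (0 : ℝ) T)) ℝ c + primitiveL T H v : L2 T H) t =
        c + ∫ s in (0 : ℝ)..t, v s
  filter_upwards [Lp.coeFn_add (Lp.constL 2 (volume.restrict (Ioo (0 : ℝ) T)) ℝ c)
    (primitiveL T H v), primitiveL_ae v,
    Lp.coeFn_const (p := 2) (μ := volume.restrict (Ioo (0 : ℝ) T)) c] with t h1 h2 h3
  rw [h1, Pi.add_apply, h2]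
  congr 1

/-- Reduces weak convergence of curves with a common initial value to weak convergence of their
derivatives. -/
theorem H1.eq_mkL (hT : 0 < T) (y : H1 T H) : y = H1.mkL T H (y.eval 0, y.deriv) := by
  have h1 := y.fst_ae
  have h2 := (H1.mkL T H (y.eval 0, y.deriv)).fst_ae
  have h3 : y.1.fst = (H1.mkL T H (y.eval 0, y.deriv)).1.fst := by
    refine Lp.ext ?_
    filter_upwards [h1, h2] with t h1 h2
    rw [h1, h2, H1.eval_mkL hT, H1.eval_eq]
  apply Subtype.ext
  apply (WithLp.equiv 2 _).injective
  exact Prod.ext h3 rfl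

theorem H1.continuousOn_eval (y : H1 T H) : ContinuousOn y.eval (Icc 0 T) :=
  continuousOn_const.add y.deriv.continuousOn_primitive

/-- Weak convergence in `H¹(0,T;H)` tested on a continuous functional. -/
theorem tendsto_apply_of_tendsto_weakSpace {y : ℕ → WeakSpace ℝ (H1 T H)}
    {a : WeakSpace ℝ (H1 T H)} (hy : Tendsto y atTop (𝓝 a)) (f : H1 T H →L[ℝ] ℝ) :
    Tendsto (fun n => f ((toWeakSpace ℝ (H1 T H)).symm (y n))) atTop
      (𝓝 (f ((toWeakSpace ℝ (H1 T H)).symm a))) :=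
  ((WeakBilin.eval_continuous (topDualPairing ℝ (H1 T H)).flip f).tendsto a).comp hy

theorem weakConv_deriv {y : ℕ → WeakSpace ℝ (H1 T H)}
    {a : WeakSpace ℝ (H1 T H)} (hy : Tendsto y atTop (𝓝 a)) :
    WeakConv (fun n => ((toWeakSpace ℝ (H1 T H)).symm (y n)).deriv)
      ((toWeakSpace ℝ (H1 T H)).symm a).deriv := fun h =>
  tendsto_apply_of_tendsto_weakSpace hy
    (innerSL ℝ h ∘L WithLp.sndL 2 ℝ (L2 T H) (L2 T H) ∘L (H1Submodule T H).subtypeL)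

variable [CompleteSpace H]

/-- Primitives at a fixed time are weakly continuous. -/
theorem WeakConv.intervalIntegral {v : ℕ → L2 T H} {w : L2 T H} (hv : WeakConv v w) {t : ℝ}
    (ht : t ∈ Icc (0 : ℝ) T) :
    WeakConv (fun n => ∫ s in (0 : ℝ)..t, v n s) (∫ s in (0 : ℝ)..t, w s) := by
  intro h
  -- Testing the primitive at time `t` with `h` is testing `f` in `L²` with `h` times the indicator
  -- of `(0,t]`.
  have key : ∀ f : L2 T H, inner ℝ h (∫ s in (0 : ℝ)..t, f s) = inner ℝ (indicatorConstLp 2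
      (μ := volume.restrict (Ioo (0 : ℝ) T)) (measurableSet_Ioc (a := (0 : ℝ)) (b := t))
        (measure_ne_top _ _) h) f := by
    intro f
    have hr : (volume.restrict (Ioo (0 : ℝ) T)).restrict (Ioc 0 t) = volume.restrict (Ioc 0 t) := by
      rw [restrict_Ioo_eq_restrict_Ioc, Measure.restrict_restrict measurableSet_Ioc,
        inter_eq_left.2 (Ioc_subset_Ioc_right ht.2)]
    rw [L2.inner_indicatorConstLp_eq_inner_setIntegral, intervalIntegral.integral_of_le ht.1, hr]
  simp only [key]
  exact hv _

theorem WeakConv.tendsto_apply {E : Type*} [NormedAddCommGroup E] [InnerProductSpace ℝ E]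
    [CompleteSpace E] {x : ℕ → E} {a : E} (hx : WeakConv x a) (f : E →L[ℝ] ℝ) :
    Tendsto (fun n => f (x n)) atTop (𝓝 (f a)) := by
  simpa only [InnerProductSpace.toDual_symm_apply] using
    hx ((InnerProductSpace.toDual ℝ E).symm f)

/-- With `c` fixed, each bounded functional of the curve is a constant plus a bounded functional of
the derivative. -/
theorem WeakConv.tendsto_mkL {v : ℕ → L2 T H} {w : L2 T H} (hv : WeakConv v w) (c : H) :
    Tendsto (fun n => toWeakSpace ℝ (H1 T H) (H1.mkL T H (c, v n))) atTop
      (𝓝 (toWeakSpace ℝ (H1 T H) (H1.mkL T H (c, w)))) := by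
  refine (WeakBilin.tendsto_iff_forall_eval_tendsto _ ?_).2 fun f => ?_
  -- The pairing separates points, by Hahn–Banach.
  · intro x y hxy
    by_contra hne
    obtain ⟨f, hf⟩ := SeparatingDual.exists_separating_of_ne (R := ℝ) (V := H1 T H) hne
    exact hf (LinearMap.congr_fun hxy f)
  · have key : ∀ z : L2 T H, f (H1.mkL T H (c, z)) =
        f (H1.mkL T H (c, 0)) + (f ∘L H1.mkL T H ∘L ContinuousLinearMap.inr ℝ H (L2 T H)) z := by
      intro z
      simp only [ContinuousLinearMap.comp_apply, ContinuousLinearMap.inr_apply, ← map_add,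
        Prod.mk_add_mk, add_zero, zero_add]
    change Tendsto (fun n => f (H1.mkL T H (c, v n))) atTop (𝓝 (f (H1.mkL T H (c, w))))
    rw [key w]
    exact (tendsto_const_nhds.add (hv.tendsto_apply _)).congr fun n => (key (v n)).symm

/-- The initial value passes to weak limits in `H¹(0,T;H)`. -/
theorem eval_zero_of_tendsto_weakSpace (hT : 0 < T) {y : ℕ → WeakSpace ℝ (H1 T H)}
    {a : WeakSpace ℝ (H1 T H)} (hy : Tendsto y atTop (𝓝 a)) {c : H}
    (hc : ∀ n, ((toWeakSpace ℝ (H1 T H)).symm (y n)).eval 0 = c) :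
    ((toWeakSpace ℝ (H1 T H)).symm a).eval 0 = c := by
  -- The curve with initial value `c` and the limit derivative is also a weak limit of `y n`;
  -- functionals separate points, so it equals `a`.
  have h1 := (weakConv_deriv hy).tendsto_mkL c
  have h2 : ((toWeakSpace ℝ (H1 T H)).symm a) =
      H1.mkL T H (c, ((toWeakSpace ℝ (H1 T H)).symm a).deriv) := by
    by_contra hne
    obtain ⟨f, hf⟩ := SeparatingDual.exists_separating_of_ne (R := ℝ) (V := H1 T H) hne
    refine hf (tendsto_nhds_unique (tendsto_apply_of_tendsto_weakSpace hy f)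
      ((tendsto_apply_of_tendsto_weakSpace h1 f).congr fun n => ?_))
    rw [LinearEquiv.symm_apply_apply]
    conv_rhs => rw [H1.eq_mkL hT ((toWeakSpace ℝ (H1 T H)).symm (y n)), hc n]
  rw [h2, H1.eval_mkL hT]
  simp

end Sobolev

end DeGiorgi

end

noncomputable section

namespace DeGiorgi

/-! ### The De Giorgi functional: value and chain rule. -/

section Functional

variable {T : ℝ} {H : Type*} [NormedAddCommGroup H] {φ : H → EReal}

theorem L2.integrable_norm_sq (f : L2 T H) :
    Integrable (fun t => ‖f t‖ ^ 2) (volume.restrict (Ioo (0 : ℝ) T)) :=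
  (memLp_two_iff_integrable_sq_norm (Lp.aestronglyMeasurable f)).1 (Lp.memLp f)

theorem lowerSemicontinuous_of_isCompact (hbot : ∀ x, φ x ≠ ⊥)
    (hsub : ∀ c : ℝ, IsCompact {x | φ x ≤ (c : EReal)}) : LowerSemicontinuous φ := by
  refine lowerSemicontinuous_iff_isClosed_preimage.2 fun c => ?_
  induction c with
  | bot =>
    have : φ ⁻¹' Iic ⊥ = ∅ := by
      ext x; simp [hbot x]
    rw [this]; exact isClosed_empty
  | coe c => exact (hsub c).isClosed
  | top => simp

/-- A minimum is attained on the compact sublevel at height `φ y₀`, and `φ` is larger outside it. -/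
theorem exists_lower_bound (hbot : ∀ x, φ x ≠ ⊥)
    (hsub : ∀ c : ℝ, IsCompact {x | φ x ≤ (c : EReal)}) {y₀ : H} (hy₀ : φ y₀ < ⊤) :
    ∃ m : ℝ, ∀ x, (m : EReal) ≤ φ x := by
  obtain ⟨r, hr⟩ := exists_real_of_ne (hbot y₀) hy₀.ne
  obtain ⟨z, hz, hmin⟩ := ((lowerSemicontinuous_of_isCompact hbot hsub).lowerSemicontinuousOn
    {x | φ x ≤ (r : EReal)}).exists_isMinOn ⟨y₀, hr.le⟩ (hsub r)
  obtain ⟨m, hm⟩ := exists_real_of_ne (hbot z) ((show φ z ≤ r from hz).trans_lt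
    (EReal.coe_lt_top _)).ne
  refine ⟨m, fun x => ?_⟩
  rw [← hm]
  rcases le_total (φ x) r with h | h
  · exact hmin h
  · exact (show φ z ≤ r from hz).trans h

theorem exists_norm_le_of_tendsto {E : Type*} [NormedAddCommGroup E] {x : ℕ → E} {a : E}
    (hx : Tendsto x atTop (𝓝 a)) : ∃ M : ℝ, ∀ n, ‖x n‖ ≤ M := by
  obtain ⟨M, hM⟩ := (Metric.isBounded_range_of_tendsto _ hx).exists_norm_le
  exact ⟨M, fun n => hM _ (mem_range_self n)⟩

variable [InnerProductSpace ℝ H]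

theorem L2.integral_norm_sq (f : L2 T H) : ∫ t in Ioo (0 : ℝ) T, ‖f t‖ ^ 2 = ‖f‖ ^ 2 := by
  rw [← real_inner_self_eq_norm_sq, L2.inner_def]
  simp only [real_inner_self_eq_norm_sq]

theorem L2.lintegral_norm_sq (f : L2 T H) :
    ∫⁻ t in Ioo (0 : ℝ) T, ENNReal.ofReal (‖f t‖ ^ 2) = ENNReal.ofReal (‖f‖ ^ 2) := by
  rw [← L2.integral_norm_sq, ofReal_integral_eq_lintegral_ofReal f.integrable_norm_sq
    (Eventually.of_forall fun _ => sq_nonneg _)]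

/-- The value of the De Giorgi functional along curves with square integrable slope. -/
theorem GDG_eq {y₀ : H} {u : L2 T H} {y : H1 T H}
    (hD : ∀ᵐ t ∂(volume.restrict (Ioo (0 : ℝ) T)), (frechetSubdiff φ (y.eval t)).Nonempty)
    (h0 : y.eval 0 = y₀) {ξ : L2 T H}
    (hξ : ∀ᵐ t ∂(volume.restrict (Ioo (0 : ℝ) T)), ξ t = subgrad φ (y.eval t)) :
    GDG T φ y₀ u y = ((1 / 2 * ‖y.deriv‖ ^ 2 + 1 / 2 * ‖ξ - u‖ ^ 2 : ℝ) : EReal)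
      - ((inner ℝ u y.deriv : ℝ) : EReal) + φ (y.eval T) - φ y₀ := by
  rw [GDG, if_pos ⟨hD, h0⟩, L2.inner_def]
  congr 3
  have h1 : ∫⁻ t in Ioo (0 : ℝ) T, ENNReal.ofReal
      (1 / 2 * ‖y.deriv t‖ ^ 2 + 1 / 2 * ‖subgrad φ (y.eval t) - u t‖ ^ 2) =
      ∫⁻ t in Ioo (0 : ℝ) T, ENNReal.ofReal
      (1 / 2 * ‖y.deriv t‖ ^ 2 + 1 / 2 * ‖(ξ - u : L2 T H) t‖ ^ 2) := by
    refine lintegral_congr_ae ?_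
    filter_upwards [hξ, Lp.coeFn_sub ξ u] with t h1 h2
    rw [h2, Pi.sub_apply, h1]
  have h2 := y.deriv.integrable_norm_sq.const_mul (1 / 2)
  have h3 := (ξ - u).integrable_norm_sq.const_mul (1 / 2)
  have h4 : Integrable (fun t => 1 / 2 * ‖y.deriv t‖ ^ 2 + 1 / 2 * ‖(ξ - u : L2 T H) t‖ ^ 2)
    (volume.restrict (Ioo (0 : ℝ) T)) := h2.add h3
  rw [h1, ← ofReal_integral_eq_lintegral_ofReal h4
    (Eventually.of_forall fun _ => by positivity), integral_add h2 h3,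
    integral_const_mul, integral_const_mul, L2.integral_norm_sq, L2.integral_norm_sq,
    EReal.coe_ennreal_ofReal, max_eq_left (by positivity)]

/-- The chain rule in integrated form. -/
theorem ChainRule.eval_eq (hchain : ChainRule T φ) (hbot : ∀ x, φ x ≠ ⊥) {y : H1 T H}
    {ξ : L2 T H}
    (hξ : ∀ᵐ t ∂(volume.restrict (Ioo (0 : ℝ) T)), ξ t ∈ frechetSubdiff φ (y.eval t))
    {t : ℝ} (ht : t ∈ Icc 0 T) :
    φ (y.eval t) = (((φ (y.eval 0)).toReal + ∫ s in (0 : ℝ)..t, inner ℝ (ξ s) (y.deriv s) : ℝ) :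
      EReal) := by
  obtain ⟨h1, h2, h3⟩ := hchain y ξ hξ
  have h4 : AbsolutelyContinuousOnInterval (fun t => (φ (y.eval t)).toReal) 0 t :=
    h2.mono (by rw [uIcc_of_le ht.1, uIcc_of_le (ht.1.trans ht.2)]; exact Icc_subset_Icc_right ht.2)
  have h5 := h4.integral_deriv_eq_sub
  have h6 : ∫ s in (0 : ℝ)..t, deriv (fun t => (φ (y.eval t)).toReal) s =
      ∫ s in (0 : ℝ)..t, inner ℝ (ξ s) (y.deriv s) :=
    intervalIntegral_congr_ae_Ioo (h3.mono fun s hs => hs.deriv) ht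
  rw [← h6, h5, add_sub_cancel, EReal.coe_toReal (h1 t ht) (hbot _)]

theorem L2.intervalIntegral_inner_eq (hT : 0 ≤ T) (f g : L2 T H) :
    ∫ s in (0 : ℝ)..T, inner ℝ (f s) (g s) = inner ℝ f g := by
  rw [L2.inner_def, intervalIntegral.integral_of_le hT, integral_Ioc_eq_integral_Ioo]

/-- Young's inequality pointwise. The bound is uniform in `t`, which keeps whole curves in one
sublevel of `φ`. -/
theorem L2.intervalIntegral_inner_le (f g : L2 T H) {t : ℝ} (ht : t ∈ Icc 0 T) :
    ∫ s in (0 : ℝ)..t, inner ℝ (f s) (g s) ≤ (‖f‖ ^ 2 + ‖g‖ ^ 2) / 2 := by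
  have hi : Integrable (fun s => (‖f s‖ ^ 2 + ‖g s‖ ^ 2) / 2)
      (volume.restrict (Ioc (0 : ℝ) T)) := by
    rw [← restrict_Ioo_eq_restrict_Ioc]
    exact (f.integrable_norm_sq.add g.integrable_norm_sq).div_const 2
  have hj : Integrable (fun s => inner ℝ (f s) (g s)) (volume.restrict (Ioc (0 : ℝ) T)) := by
    rw [← restrict_Ioo_eq_restrict_Ioc]
    exact L2.integrable_inner f g
  have hsub : Ioc 0 t ⊆ Ioc 0 T := Ioc_subset_Ioc_right ht.2
  rw [intervalIntegral.integral_of_le ht.1]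
  calc ∫ s in Ioc 0 t, inner ℝ (f s) (g s)
      ≤ ∫ s in Ioc 0 t, (‖f s‖ ^ 2 + ‖g s‖ ^ 2) / 2 := by
        refine integral_mono (IntegrableOn.mono_set hj hsub) (IntegrableOn.mono_set hi hsub)
          fun s => ?_
        have := real_inner_le_norm (f s) (g s)
        dsimp only
        nlinarith [sq_nonneg (‖f s‖ - ‖g s‖)]
    _ ≤ ∫ s in Ioc 0 T, (‖f s‖ ^ 2 + ‖g s‖ ^ 2) / 2 :=
        setIntegral_mono_set hi (Eventually.of_forall fun _ => by positivity)
          (Eventually.of_forall hsub)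
    _ = (‖f‖ ^ 2 + ‖g‖ ^ 2) / 2 := by
        rw [integral_Ioc_eq_integral_Ioo, integral_div, integral_add f.integrable_norm_sq
          g.integrable_norm_sq, L2.integral_norm_sq, L2.integral_norm_sq]

/-! ### Coercivity, lower semicontinuity and compactness of the De Giorgi functional. -/

variable [CompleteSpace H] [TopologicalSpace.SeparableSpace H]

theorem ClosedSingleSubdiff.aestronglyMeasurable_subgrad (hφ : ClosedSingleSubdiff φ)
    (y : H1 T H) : AEStronglyMeasurable (fun t => subgrad φ (y.eval t))
      (volume.restrict (Ioo (0 : ℝ) T)) := by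
  borelize H
  have : SecondCountableTopology H := UniformSpace.secondCountable_of_separable H
  exact (hφ.measurable_subgrad.comp_aemeasurable
    ((y.continuousOn_eval.mono Ioo_subset_Icc_self).aemeasurable
      measurableSet_Ioo)).aestronglyMeasurable

/-- A curve along which `‖∂φ(y) - u‖` is square integrable has a slope in `L²`. -/
theorem ClosedSingleSubdiff.exists_L2_subgrad (hφ : ClosedSingleSubdiff φ) {y : H1 T H}
    {u : L2 T H} (h : ∫⁻ t in Ioo (0 : ℝ) T,
      ENNReal.ofReal (‖subgrad φ (y.eval t) - u t‖ ^ 2) ≠ ⊤) :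
    ∃ ξ : L2 T H, ∀ᵐ t ∂(volume.restrict (Ioo (0 : ℝ) T)), ξ t = subgrad φ (y.eval t) := by
  have hm : AEStronglyMeasurable (fun t => subgrad φ (y.eval t) - u t)
      (volume.restrict (Ioo (0 : ℝ) T)) :=
    (hφ.aestronglyMeasurable_subgrad y).sub (Lp.aestronglyMeasurable u)
  have h1 : MemLp (fun t => subgrad φ (y.eval t) - u t) 2 (volume.restrict (Ioo (0 : ℝ) T)) := by
    refine (memLp_two_iff_integrable_sq_norm hm).2 ⟨hm.norm.pow 2, ?_⟩
    rw [hasFiniteIntegral_iff_ofReal (Eventually.of_forall fun _ => sq_nonneg _)]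
    exact lt_top_iff_ne_top.2 h
  have h2 : MemLp (fun t => subgrad φ (y.eval t)) 2 (volume.restrict (Ioo (0 : ℝ) T)) := by
    simpa [Pi.add_def] using h1.add (Lp.memLp u)
  exact ⟨h2.toLp _, h2.coeFn_toLp⟩

/-- No other term of the functional equals `-∞`, so nothing can cancel an infinite slope integral.
-/
theorem ClosedSingleSubdiff.of_GDG_lt_top (hφ : ClosedSingleSubdiff φ) (hbot : ∀ x, φ x ≠ ⊥)
    {y₀ : H} (hy₀ : φ y₀ < ⊤) {u : L2 T H} {y : H1 T H} (h : GDG T φ y₀ u y < ⊤) :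
    (∀ᵐ t ∂(volume.restrict (Ioo (0 : ℝ) T)), (frechetSubdiff φ (y.eval t)).Nonempty) ∧
      y.eval 0 = y₀ ∧
      ∃ ξ : L2 T H, ∀ᵐ t ∂(volume.restrict (Ioo (0 : ℝ) T)), ξ t = subgrad φ (y.eval t) := by
  rw [GDG] at h
  split_ifs at h with hc
  · refine ⟨hc.1, hc.2, hφ.exists_L2_subgrad (u := u) fun htop => ?_⟩
    have h1 : (∫⁻ t in Ioo (0 : ℝ) T, ENNReal.ofReal
        (1 / 2 * ‖y.deriv t‖ ^ 2 + 1 / 2 * ‖subgrad φ (y.eval t) - u t‖ ^ 2)) = ⊤ := by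
      rw [← top_le_iff]
      calc (⊤ : ENNReal) = ENNReal.ofReal (1 / 2) * ∫⁻ t in Ioo (0 : ℝ) T,
            ENNReal.ofReal (‖subgrad φ (y.eval t) - u t‖ ^ 2) := by
              rw [htop, ENNReal.mul_top (by simp)]
        _ = ∫⁻ t in Ioo (0 : ℝ) T, ENNReal.ofReal
            (1 / 2 * ‖subgrad φ (y.eval t) - u t‖ ^ 2) := by
              rw [← lintegral_const_mul' _ _ ENNReal.ofReal_ne_top]
              simp_rw [ENNReal.ofReal_mul (show (0 : ℝ) ≤ 1 / 2 by norm_num)]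
        _ ≤ _ := by
              refine lintegral_mono fun t => ENNReal.ofReal_le_ofReal ?_
              have : 0 ≤ 1 / 2 * ‖y.deriv t‖ ^ 2 := by positivity
              linarith
    obtain ⟨r, hr⟩ := exists_real_of_ne (hbot y₀) hy₀.ne
    rw [h1, EReal.coe_ennreal_top, EReal.top_sub_coe, EReal.top_add_of_ne_bot (hbot _), hr,
      EReal.top_sub_coe] at h
    exact lt_irrefl _ h
  · exact absurd h (lt_irrefl _)

/-- The De Giorgi functional is the squared residual of the gradient flow. -/
theorem ClosedSingleSubdiff.GDG_nonneg (hφ : ClosedSingleSubdiff φ) (hT : 0 ≤ T)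
    (hbot : ∀ x, φ x ≠ ⊥) (hchain : ChainRule T φ) {y₀ : H} (hy₀ : φ y₀ < ⊤) (u : L2 T H)
    (y : H1 T H) : 0 ≤ GDG T φ y₀ u y := by
  by_cases h : GDG T φ y₀ u y < ⊤
  · obtain ⟨hD, h0, ξ, hξ⟩ := hφ.of_GDG_lt_top hbot hy₀ h
    have hξ' : ∀ᵐ t ∂(volume.restrict (Ioo (0 : ℝ) T)), ξ t ∈ frechetSubdiff φ (y.eval t) := by
      filter_upwards [hD, hξ] with t h1 h2
      rw [h2]; exact subgrad_mem h1
    have h1 := hchain.eval_eq hbot hξ' (right_mem_Icc.2 hT)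
    obtain ⟨r, hr⟩ := exists_real_of_ne (hbot y₀) hy₀.ne
    rw [L2.intervalIntegral_inner_eq hT, h0, hr, EReal.toReal_coe] at h1
    rw [GDG_eq hD h0 hξ, h1, hr, ← EReal.coe_sub, ← EReal.coe_add, ← EReal.coe_sub,
      ← EReal.coe_zero, EReal.coe_le_coe_iff]
    -- The chain rule has replaced the energy difference by `(ξ, y')`; what remains is `½‖y' + (ξ -
    -- u)‖²`.
    have h2 := norm_add_sq_real y.deriv (ξ - u)
    rw [inner_sub_right, real_inner_comm, real_inner_comm u] at h2
    nlinarith [sq_nonneg ‖y.deriv + (ξ - u)‖]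
  · rw [not_lt_top_iff.1 h]; exact le_top

/-- Coercivity of the De Giorgi functional. -/
theorem ClosedSingleSubdiff.exists_bound (hφ : ClosedSingleSubdiff φ) (hT : 0 ≤ T)
    (hbot : ∀ x, φ x ≠ ⊥) {m : ℝ} (hm : ∀ x, (m : EReal) ≤ φ x) (hchain : ChainRule T φ) {y₀ : H}
    (hy₀ : φ y₀ < ⊤) (M c : ℝ) :
    ∃ R : ℝ, ∀ (u : L2 T H) (y : H1 T H), ‖u‖ ≤ M → GDG T φ y₀ u y ≤ c →
      ‖y.deriv‖ ≤ R ∧ ∀ ξ : L2 T H,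
        (∀ᵐ t ∂(volume.restrict (Ioo (0 : ℝ) T)), ξ t = subgrad φ (y.eval t)) →
        ‖ξ - u‖ ^ 2 ≤ R ∧ ∀ t ∈ Icc 0 T, φ (y.eval t) ≤ R := by
  obtain ⟨r, hr⟩ := exists_real_of_ne (hbot y₀) hy₀.ne
  -- Absorbing `(u, y') ≤ M² + ¼‖y'‖²` leaves `¼‖y'‖² + ½‖ξ - u‖² ≤ C`. Hence the bounds `4 C` and
  -- `2 C`, and `φ(y(t)) ≤ |r| + 4 C + M²`; the radius below dominates all three, its `1` serving to
  -- pass from `‖y'‖²` to `‖y'‖`.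
  set C : ℝ := |c + r - m| + M ^ 2
  have hC0 : 0 ≤ C := by positivity
  refine ⟨|r| + 4 * C + 1 + M ^ 2 + 2 * C, fun u y hu hG => ?_⟩
  obtain ⟨hD, h0, ζ, hζ⟩ := hφ.of_GDG_lt_top hbot hy₀ (hG.trans_lt (EReal.coe_lt_top _))
  have key : ∀ ξ : L2 T H,
      (∀ᵐ t ∂(volume.restrict (Ioo (0 : ℝ) T)), ξ t = subgrad φ (y.eval t)) →
      ‖y.deriv‖ ^ 2 ≤ 4 * C ∧ ‖ξ - u‖ ^ 2 ≤ 2 * C ∧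
        ∀ t ∈ Icc 0 T, φ (y.eval t) ≤ ((r + (‖ξ‖ ^ 2 + ‖y.deriv‖ ^ 2) / 2 : ℝ) : EReal) := by
    intro ξ hξ
    have hξ' : ∀ᵐ t ∂(volume.restrict (Ioo (0 : ℝ) T)), ξ t ∈ frechetSubdiff φ (y.eval t) := by
      filter_upwards [hD, hξ] with t h1 h2
      rw [h2]; exact subgrad_mem h1
    have h1 := hchain.eval_eq hbot hξ' (right_mem_Icc.2 hT)
    set p := (φ (y.eval 0)).toReal + ∫ s in (0 : ℝ)..T, inner ℝ (ξ s) (y.deriv s)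
    have h2 : m ≤ p := by
      have := hm (y.eval T)
      rw [h1] at this
      exact EReal.coe_le_coe_iff.1 this
    rw [GDG_eq hD h0 hξ, h1, hr, ← EReal.coe_sub, ← EReal.coe_add, ← EReal.coe_sub,
      EReal.coe_le_coe_iff] at hG
    have h3 : inner ℝ u y.deriv ≤ M * ‖y.deriv‖ :=
      (real_inner_le_norm _ _).trans (by gcongr)
    have h4 : M * ‖y.deriv‖ ≤ M ^ 2 + 1 / 4 * ‖y.deriv‖ ^ 2 := by
      nlinarith [sq_nonneg (M - ‖y.deriv‖ / 2)]
    have h5 := le_abs_self (c + r - m)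
    have h6 := sq_nonneg ‖y.deriv‖
    have h7 := sq_nonneg ‖ξ - u‖
    refine ⟨by linarith, by linarith, fun t ht => ?_⟩
    rw [hchain.eval_eq hbot hξ' ht, h0, hr, EReal.toReal_coe, EReal.coe_le_coe_iff]
    linarith [L2.intervalIntegral_inner_le ξ y.deriv ht]
  obtain ⟨k1, -, -⟩ := key ζ hζ
  have hr' := le_abs_self r
  have hr'' := abs_nonneg r
  have hM := sq_nonneg M
  refine ⟨by nlinarith [sq_nonneg (‖y.deriv‖ - 1)], fun ξ hξ => ?_⟩
  obtain ⟨-, k2, k3⟩ := key ξ hξ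
  refine ⟨by linarith, fun t ht => (k3 t ht).trans (EReal.coe_le_coe_iff.2 ?_)⟩
  have h8 : ‖ξ‖ ≤ ‖ξ - u‖ + M := by
    have := norm_add_le (ξ - u) u
    rw [sub_add_cancel] at this
    linarith
  have h9 : ‖ξ‖ ^ 2 ≤ 2 * ‖ξ - u‖ ^ 2 + 2 * M ^ 2 := by
    have : ‖ξ‖ ^ 2 ≤ (‖ξ - u‖ + M) ^ 2 := by gcongr
    nlinarith [sq_nonneg (‖ξ - u‖ - M)]
  linarith

/-- Lower semicontinuity of the slope term under pointwise convergence. -/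
theorem ClosedSingleSubdiff.slope_lsc (hφ : ClosedSingleSubdiff φ) {y : ℕ → H1 T H} {a : H1 T H}
    (hy : ∀ t ∈ Icc 0 T, Tendsto (fun n => (y n).eval t) atTop (𝓝 (a.eval t)))
    {u : ℕ → L2 T H} {b : L2 T H}
    (hu : ∀ᵐ t ∂(volume.restrict (Ioo (0 : ℝ) T)), Tendsto (fun n => u n t) atTop (𝓝 (b t)))
    (hD : ∀ n, ∀ᵐ t ∂(volume.restrict (Ioo (0 : ℝ) T)),
      (frechetSubdiff φ ((y n).eval t)).Nonempty)
    {ξ : ℕ → L2 T H} (hξ : ∀ n, ∀ᵐ t ∂(volume.restrict (Ioo (0 : ℝ) T)),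
      ξ n t = subgrad φ ((y n).eval t)) {K : ℝ}
    (hK : ∀ᶠ n in atTop, ‖ξ n - u n‖ ^ 2 ≤ K) :
    (∀ᵐ t ∂(volume.restrict (Ioo (0 : ℝ) T)), (frechetSubdiff φ (a.eval t)).Nonempty) ∧
      ∃ ζ : L2 T H, (∀ᵐ t ∂(volume.restrict (Ioo (0 : ℝ) T)), ζ t = subgrad φ (a.eval t)) ∧
        ‖ζ - b‖ ^ 2 ≤ K := by
  set g : ℕ → ℝ → ENNReal := fun n t =>
    ENNReal.ofReal (‖subgrad φ ((y n).eval t) - u n t‖ ^ 2)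
  have hK0 : 0 ≤ K := by
    obtain ⟨n, hn⟩ := hK.exists
    exact (sq_nonneg _).trans hn
  have hgm : ∀ n, AEMeasurable (g n) (volume.restrict (Ioo (0 : ℝ) T)) := fun n =>
    (((hφ.aestronglyMeasurable_subgrad (y n)).sub
      (Lp.aestronglyMeasurable (u n))).norm.pow 2).aemeasurable.ennreal_ofReal
  have hgi : ∀ n, ∫⁻ t in Ioo (0 : ℝ) T, g n t = ENNReal.ofReal (‖ξ n - u n‖ ^ 2) := by
    intro n
    rw [← L2.lintegral_norm_sq]
    refine lintegral_congr_ae ?_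
    filter_upwards [hξ n, Lp.coeFn_sub (ξ n) (u n)] with t h1 h2
    rw [h2, Pi.sub_apply, h1]
  -- Fatou's lemma. The liminf is then finite a.e., so at a.e. `t` the slopes are bounded along a
  -- subsequence depending on `t`, which is all that the pointwise semicontinuity needs.
  have hfatou : ∫⁻ t in Ioo (0 : ℝ) T, liminf (fun n => g n t) atTop ≤ ENNReal.ofReal K := by
    refine (lintegral_liminf_le' hgm).trans ?_
    simp only [hgi]
    refine (liminf_le_liminf (hK.mono fun n hn => ENNReal.ofReal_le_ofReal hn)).trans ?_
    simp
  have hfin : ∀ᵐ t ∂(volume.restrict (Ioo (0 : ℝ) T)), liminf (fun n => g n t) atTop < ⊤ :=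
    ae_lt_top' (by
      simp_rw [liminf_eq_iSup_iInf_of_nat]
      exact .iSup fun n => .biInf _ (to_countable _) fun i _ => hgm i)
      (hfatou.trans_lt ENNReal.ofReal_lt_top).ne
  have hpt : ∀ᵐ t ∂(volume.restrict (Ioo (0 : ℝ) T)), (frechetSubdiff φ (a.eval t)).Nonempty ∧
      ENNReal.ofReal (‖subgrad φ (a.eval t) - b t‖ ^ 2) ≤ liminf (fun n => g n t) atTop := by
    filter_upwards [hu, hfin, ae_all_iff.2 hD, ae_restrict_mem measurableSet_Ioo] with t h1 h2 h3 ht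
    have key : ∀ q : NNReal, liminf (fun n => g n t) atTop < q →
        (frechetSubdiff φ (a.eval t)).Nonempty ∧
          ENNReal.ofReal (‖subgrad φ (a.eval t) - b t‖ ^ 2) ≤ q := by
      intro q hq
      have hfr : ∃ᶠ n in atTop, ‖subgrad φ ((y n).eval t) - u n t‖ ≤ √(q : ℝ) := by
        refine (frequently_lt_of_liminf_lt (by isBoundedDefault) hq).mono fun n hn => ?_
        have h4 : ‖subgrad φ ((y n).eval t) - u n t‖ ^ 2 ≤ q :=
          (ENNReal.ofReal_le_coe).1 hn.le
        exact Real.le_sqrt_of_sq_le h4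
      obtain ⟨h5, h6⟩ := hφ.norm_subgrad_sub_le (hy t (Ioo_subset_Icc_self ht)) h1 h3 hfr
      refine ⟨h5, ENNReal.ofReal_le_coe.2 ?_⟩
      calc _ ≤ √(q : ℝ) ^ 2 := by gcongr
        _ = q := Real.sq_sqrt q.2
    obtain ⟨q, hq, -⟩ := ENNReal.lt_iff_exists_nnreal_btwn.1 h2
    refine ⟨(key q hq).1, ?_⟩
    by_contra! hlt
    obtain ⟨q', hq', hq''⟩ := ENNReal.lt_iff_exists_nnreal_btwn.1 hlt
    exact absurd hq'' (not_lt.2 (key q' hq').2)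
  have hle : ∫⁻ t in Ioo (0 : ℝ) T, ENNReal.ofReal (‖subgrad φ (a.eval t) - b t‖ ^ 2) ≤
      ENNReal.ofReal K :=
    (lintegral_mono_ae (hpt.mono fun t ht => ht.2)).trans hfatou
  obtain ⟨ζ, hζ⟩ := hφ.exists_L2_subgrad (hle.trans_lt ENNReal.ofReal_lt_top).ne
  refine ⟨hpt.mono fun t ht => ht.1, ζ, hζ, ?_⟩
  have h7 : ∫⁻ t in Ioo (0 : ℝ) T, ENNReal.ofReal (‖subgrad φ (a.eval t) - b t‖ ^ 2) =
      ENNReal.ofReal (‖ζ - b‖ ^ 2) := by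
    rw [← L2.lintegral_norm_sq]
    refine lintegral_congr_ae ?_
    filter_upwards [hζ, Lp.coeFn_sub ζ b] with t h1 h2
    rw [h2, Pi.sub_apply, h1]
  rw [h7] at hle
  exact (ENNReal.ofReal_le_ofReal_iff hK0).1 hle

/-- Sequential lower semicontinuity of the De Giorgi functional for the strong-weak topology. -/
theorem ClosedSingleSubdiff.constraint_lsc (hφ : ClosedSingleSubdiff φ) (hT : 0 < T)
    (hbot : ∀ x, φ x ≠ ⊥) (hsub : ∀ c : ℝ, IsCompact {x | φ x ≤ (c : EReal)})
    (hchain : ChainRule T φ) {y₀ : H} (hy₀ : φ y₀ < ⊤) {x : ℕ → PhaseSpace T H}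
    {a : PhaseSpace T H} (hx : Tendsto x atTop (𝓝 a)) {c : ℝ}
    (hc : ∀ n, constraint T φ y₀ (x n) ≤ c) : constraint T φ y₀ a ≤ c := by
  have hu₀ : Tendsto (fun n => (x n).1) atTop (𝓝 a.1) := (continuous_fst.tendsto a).comp hx
  -- The controls converge a.e. along a subsequence, on which the bound `c` still holds.
  obtain ⟨k, hk, hae⟩ := (tendstoInMeasure_of_tendsto_Lp hu₀).exists_seq_tendsto_ae
  replace hx := hx.comp hk.tendsto_atTop
  set u : ℕ → L2 T H := fun n => (x (k n)).1
  set y : ℕ → H1 T H := fun n => (toWeakSpace ℝ (H1 T H)).symm (x (k n)).2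
  set b : H1 T H := (toWeakSpace ℝ (H1 T H)).symm a.2
  have hu : Tendsto u atTop (𝓝 a.1) := (continuous_fst.tendsto a).comp hx
  have hyw : Tendsto (fun n => (x (k n)).2) atTop (𝓝 a.2) := (continuous_snd.tendsto a).comp hx
  have hG : ∀ n, GDG T φ y₀ (u n) (y n) ≤ c := fun n => hc (k n)
  choose hD h0 ξ hξ using fun n => hφ.of_GDG_lt_top hbot hy₀
    ((hG n).trans_lt (EReal.coe_lt_top _))
  obtain ⟨m, hm⟩ := exists_lower_bound hbot hsub hy₀
  obtain ⟨M, hM⟩ := exists_norm_le_of_tendsto hu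
  obtain ⟨R, hR⟩ := hφ.exists_bound hT.le hbot hm hchain hy₀ M c
  have hRn := fun n => hR (u n) (y n) (hM n) (hG n)
  have hv : WeakConv (fun n => (y n).deriv) b.deriv := weakConv_deriv hyw
  have hb0 : b.eval 0 = y₀ := eval_zero_of_tendsto_weakSpace hT hyw h0
  -- All `y n` take values in the compact sublevel `{φ ≤ R}`, which upgrades weak to strong
  -- convergence at each time.
  have hy : ∀ t ∈ Icc 0 T, Tendsto (fun n => (y n).eval t) atTop (𝓝 (b.eval t)) := by
    intro t ht
    refine WeakConv.tendsto_of_isCompact ?_ (hsub R) fun n => ((hRn n).2 (ξ n) (hξ n)).2 t ht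
    have h1 := (Tendsto.weakConv (tendsto_const_nhds (x := y₀))).add (hv.intervalIntegral ht)
    rw [H1.eval_eq, hb0]
    refine fun h => (h1 h).congr fun n => ?_
    dsimp only
    rw [(y n).eval_eq t, h0 n]
  -- The crude bound `R` only serves to give the limit curve a slope in `L²`, hence a finite
  -- `φ(b(T))`. The sharp bound comes from a second application below.
  obtain ⟨hDb, ζ, hζ, -⟩ := hφ.slope_lsc hy hae hD hξ
    (Eventually.of_forall fun n => ((hRn n).2 (ξ n) (hξ n)).1)
  have mem_of : ∀ (z : H1 T H) (ξ : L2 T H),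
      (∀ᵐ t ∂(volume.restrict (Ioo (0 : ℝ) T)), (frechetSubdiff φ (z.eval t)).Nonempty) →
      (∀ᵐ t ∂(volume.restrict (Ioo (0 : ℝ) T)), ξ t = subgrad φ (z.eval t)) →
      ∃ p : ℝ, φ (z.eval T) = p := by
    intro z ξ h1 h2
    refine ⟨_, hchain.eval_eq hbot (ξ := ξ) ?_ (right_mem_Icc.2 hT.le)⟩
    filter_upwards [h1, h2] with t h1 h2
    rw [h2]; exact subgrad_mem h1
  obtain ⟨p, hp⟩ := mem_of b ζ hDb hζ
  choose pn hpn using fun n => mem_of (y n) (ξ n) (hD n) (hξ n)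
  obtain ⟨r, hr⟩ := exists_real_of_ne (hbot y₀) hy₀.ne
  have hval : ∀ n, 1 / 2 * ‖(y n).deriv‖ ^ 2 + 1 / 2 * ‖ξ n - u n‖ ^ 2
      - inner ℝ (u n) (y n).deriv + pn n - r ≤ c := by
    intro n
    have h1 := hG n
    rwa [GDG_eq (hD n) (h0 n) (hξ n), hpn, hr, ← EReal.coe_sub, ← EReal.coe_add, ← EReal.coe_sub,
      EReal.coe_le_coe_iff] at h1
  have hin : Tendsto (fun n => inner ℝ (u n) (y n).deriv) atTop (𝓝 (inner ℝ a.1 b.deriv)) :=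
    WeakConv.tendsto_inner hu hv fun n => (hRn n).1
  change GDG T φ y₀ a.1 b ≤ c
  rw [GDG_eq hDb hb0 hζ, hp, hr, ← EReal.coe_sub, ← EReal.coe_add, ← EReal.coe_sub,
    EReal.coe_le_coe_iff]
  refine le_of_forall_pos_le_add fun δ hδ => ?_
  -- The losses are `δ/2` from the halved squared norm and `δ/4` each from the pairing and the final
  -- energy, `δ` in total. The slope term thus receives the remaining budget, doubled in `K` because
  -- of its factor `½`.
  have e1 := hv.eventually_lt_norm_sq (r := ‖b.deriv‖ ^ 2 - δ) (by linarith)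
  have e2 := hin.eventually_lt_const (u := inner ℝ a.1 b.deriv + δ / 4) (by linarith)
  have e3 : ∀ᶠ n in atTop, p - δ / 4 < pn n := by
    have h1 := (hy T (right_mem_Icc.2 hT.le)).eventually
      (lowerSemicontinuous_of_isCompact hbot hsub (b.eval T) ((p - δ / 4 : ℝ) : EReal)
        (by change _ < φ (b.eval T); rw [hp]; exact_mod_cast (by linarith : p - δ / 4 < p)))
    refine h1.mono fun n hn => ?_
    change _ < φ ((y n).eval T) at hn
    rw [hpn] at hn
    exact_mod_cast hn
  obtain ⟨-, ζ', hζ', hle⟩ := hφ.slope_lsc hy hae hD hξ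
    (K := 2 * (c + r - 1 / 2 * ‖b.deriv‖ ^ 2 + inner ℝ a.1 b.deriv - p + δ)) (by
      filter_upwards [e1, e2, e3] with n h1 h2 h3
      have := hval n
      linarith)
  have hzz : ζ' = ζ := by
    refine Lp.ext ?_
    filter_upwards [hζ, hζ'] with t h1 h2
    rw [h1, h2]
  rw [hzz] at hle
  linarith

/-- Compactness of sublevels of the De Giorgi functional over a compact set of controls. -/
theorem ClosedSingleSubdiff.constraint_compact (hφ : ClosedSingleSubdiff φ) (hT : 0 < T)
    (hbot : ∀ x, φ x ≠ ⊥) (hsub : ∀ c : ℝ, IsCompact {x | φ x ≤ (c : EReal)})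
    (hchain : ChainRule T φ) {y₀ : H} (hy₀ : φ y₀ < ⊤) {U : Set (L2 T H)} (hU : IsCompact U)
    {x : ℕ → PhaseSpace T H} (hxU : ∀ n, (x n).1 ∈ U) {c : ℝ}
    (hc : ∀ n, constraint T φ y₀ (x n) ≤ c) :
    ∃ (k : ℕ → ℕ) (a : PhaseSpace T H), StrictMono k ∧
      Tendsto (fun n => x (k n)) atTop (𝓝 a) := by
  -- Used for the separability of `L²`, on which weak sequential compactness rests.
  have : Fact ((2 : ENNReal) ≠ ⊤) := ⟨by norm_num⟩
  obtain ⟨b, -, k, hk, hb⟩ := hU.tendsto_subseq hxU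
  obtain ⟨m, hm⟩ := exists_lower_bound hbot hsub hy₀
  obtain ⟨M, hM⟩ := exists_norm_le_of_tendsto hb
  obtain ⟨R, hR⟩ := hφ.exists_bound hT.le hbot hm hchain hy₀ M c
  set y : ℕ → H1 T H := fun n => (toWeakSpace ℝ (H1 T H)).symm (x (k n)).2
  obtain ⟨v, l, hl, hv⟩ := exists_weakConv_subseq (x := fun n => (y n).deriv) (R := R)
    fun n => (hR _ (y n) (hM n) (hc (k n))).1
  refine ⟨k ∘ l, (b, toWeakSpace ℝ (H1 T H) (H1.mkL T H (y₀, v))), hk.comp hl, ?_⟩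
  refine (hb.comp hl.tendsto_atTop).prodMk_nhds ((hv.tendsto_mkL y₀).congr fun n => ?_)
  have h0 : (y (l n)).eval 0 = y₀ :=
    (hφ.of_GDG_lt_top hbot hy₀ ((hc (k (l n))).trans_lt (EReal.coe_lt_top _))).2.1
  rw [← h0, ← H1.eq_mkL hT]
  rfl

end Functional

end DeGiorgi

end

noncomputable section

namespace DeGiorgi

/-! ### Abstract penalization and Γ-convergence. -/

section Penalization

variable {X : Type*} {F : X → ENNReal} {G : X → EReal}

theorem coe_toReal_ennreal {a : ENNReal} (ha : a ≠ ⊤) : ((a.toReal : ℝ) : EReal) = (a : EReal) := by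
  lift a to NNReal using ha
  rfl

theorem penalized_nonneg (hG : ∀ x, 0 ≤ G x) {ε : ℝ} (hε : 0 < ε) (x : X) :
    0 ≤ penalized F G ε x :=
  add_nonneg (EReal.coe_ennreal_nonneg _)
    (mul_nonneg (EReal.coe_nonneg.2 (inv_nonneg.2 hε.le)) (hG x))

/-- At points of finite penalized energy both terms are finite. -/
theorem exists_real_of_penalized_lt_top (hG : ∀ x, 0 ≤ G x) {ε : ℝ} (hε : 0 < ε) {x : X}
    (h : penalized F G ε x < ⊤) :
    ∃ f g : ℝ, 0 ≤ f ∧ 0 ≤ g ∧ F x = ENNReal.ofReal f ∧ G x = g ∧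
      penalized F G ε x = ((f + ε⁻¹ * g : ℝ) : EReal) := by
  have hGb : G x ≠ ⊥ := ne_bot_of_le_ne_bot EReal.zero_ne_bot (hG x)
  have hinv : 0 < ε⁻¹ := inv_pos.2 hε
  have hprod : 0 ≤ ((ε⁻¹ : ℝ) : EReal) * G x := mul_nonneg (EReal.coe_nonneg.2 hinv.le) (hG x)
  have hF : F x ≠ ⊤ := by
    intro hF
    rw [penalized, hF, EReal.coe_ennreal_top,
      EReal.top_add_of_ne_bot (ne_bot_of_le_ne_bot EReal.zero_ne_bot hprod)] at h
    exact lt_irrefl _ h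
  have hGt : G x ≠ ⊤ := by
    intro hGt
    rw [penalized, hGt, EReal.coe_mul_top_of_pos hinv,
      EReal.add_top_of_ne_bot (EReal.coe_ennreal_ne_bot _)] at h
    exact lt_irrefl _ h
  obtain ⟨g, hg⟩ := exists_real_of_ne hGb hGt
  refine ⟨(F x).toReal, g, ENNReal.toReal_nonneg, ?_, (ENNReal.ofReal_toReal hF).symm, hg, ?_⟩
  · have := hG x
    rw [hg] at this
    exact EReal.coe_nonneg.1 this
  · rw [penalized, hg, EReal.coe_add, EReal.coe_mul, coe_toReal_ennreal hF]

theorem penalized_eq_of_eq_zero {x : X} (h : G x = 0) (ε : ℝ) :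
    penalized F G ε x = (F x : EReal) := by
  rw [penalized, h, mul_zero, add_zero]

/-- Off the zero set `G x` exceeds some `q > 0`, and `q / ε` diverges. Constant sequences therefore
serve as recovery sequences. -/
theorem tendsto_penalized (hG : ∀ x, 0 ≤ G x) {ε : ℕ → ℝ} (hε : IsVanishing ε) (x : X) :
    Tendsto (fun n => penalized F G (ε n) x) atTop (𝓝 (constrained F G x)) := by
  by_cases h : G x = 0
  · rw [constrained, if_pos h]
    exact tendsto_const_nhds.congr fun n => (penalized_eq_of_eq_zero h _).symm
  · rw [constrained, if_neg h, EReal.tendsto_nhds_top_iff_real]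
    intro c
    have hpos : 0 < G x := lt_of_le_of_ne (hG x) (Ne.symm h)
    obtain ⟨q, hq0, hq⟩ := EReal.lt_iff_exists_real_btwn.1 hpos
    have hq0' : 0 < q := EReal.coe_pos.1 hq0
    have hinv : Tendsto (fun n => (ε n)⁻¹) atTop atTop :=
      (tendsto_nhdsWithin_iff.2 ⟨hε.2, Eventually.of_forall hε.1⟩).inv_tendsto_nhdsGT_zero
    filter_upwards [hinv.eventually_gt_atTop (c / q)] with n hn
    have h1 : c < (ε n)⁻¹ * q := (div_lt_iff₀ hq0').1 hn
    calc (c : EReal) < (((ε n)⁻¹ * q : ℝ) : EReal) := EReal.coe_lt_coe_iff.2 h1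
      _ = (((ε n)⁻¹ : ℝ) : EReal) * (q : EReal) := EReal.coe_mul _ _
      _ ≤ (((ε n)⁻¹ : ℝ) : EReal) * G x :=
        mul_le_mul_of_nonneg_left hq.le (EReal.coe_nonneg.2 (inv_nonneg.2 (hε.1 n).le))
      _ ≤ penalized F G (ε n) x := le_add_of_nonneg_left (EReal.coe_ennreal_nonneg _)

theorem IsVanishing.comp {ε : ℕ → ℝ} (hε : IsVanishing ε) {k : ℕ → ℕ}
    (hk : Tendsto k atTop atTop) : IsVanishing (fun n => ε (k n)) :=
  ⟨fun _ => hε.1 _, hε.2.comp hk⟩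

/-- The upper bounds `1 / (n + 1)` hold along a subsequence. Lower bounds are inherited from the
liminf, since the differences may equal `-∞` when both energies are infinite. -/
theorem exists_isQuasimin_subseq {E : ℝ → X → EReal} {ε : ℕ → ℝ} {x : ℕ → X}
    (hx : IsLiminfQuasimin E ε x) :
    ∃ k : ℕ → ℕ, StrictMono k ∧ IsQuasimin E (fun n => ε (k n)) (fun n => x (k n)) := by
  set e : ℕ → EReal := fun n => E (ε n) (x n) - ⨅ z, E (ε n) z
  have hx' : liminf e atTop = 0 := hx
  have hfr : ∀ n : ℕ, ∃ᶠ j in atTop, e j < ((1 / ((n : ℝ) + 1) : ℝ) : EReal) := fun n =>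
    frequently_lt_of_liminf_lt (by isBoundedDefault)
      (by rw [hx']; exact EReal.coe_pos.2 (by positivity))
  obtain ⟨k, hk, hke⟩ := extraction_forall_of_frequently hfr
  refine ⟨k, hk, tendsto_order.2 ⟨fun c hc => ?_, fun c hc => ?_⟩⟩
  · exact hk.tendsto_atTop.eventually (eventually_lt_of_lt_liminf (u := e) (by rwa [hx']))
  · obtain ⟨q, hq0, hq⟩ := EReal.lt_iff_exists_real_btwn.1 hc
    filter_upwards [(tendsto_one_div_add_atTop_nhds_zero_nat (𝕜 := ℝ)).eventually_lt_const
      (EReal.coe_pos.1 hq0)] with n hn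
    exact (hke n).trans ((EReal.coe_lt_coe_iff.2 hn).trans hq)

variable [TopologicalSpace X]

/-- A constraint functional with closed sublevels along sequences, whose sublevels are
sequentially relatively compact on the domain of `F`. -/
structure CoerciveConstraint (F : X → ENNReal) (G : X → EReal) : Prop where
  nonneg : ∀ x, 0 ≤ G x
  closed : ∀ (x : ℕ → X) (a : X) (c : ℝ), Tendsto x atTop (𝓝 a) → (∀ n, G (x n) ≤ c) → G a ≤ c
  compact : ∀ (x : ℕ → X) (c : ℝ), (∀ n, F (x n) < ⊤) → (∀ n, G (x n) ≤ c) →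
    ∃ (k : ℕ → ℕ) (a : X), StrictMono k ∧ Tendsto (fun n => x (k n)) atTop (𝓝 a)

theorem CoerciveConstraint.le_of_frequently (h : CoerciveConstraint F G) {x : ℕ → X} {a : X}
    (hx : Tendsto x atTop (𝓝 a)) {c : ℝ} (hc : ∃ᶠ n in atTop, G (x n) ≤ c) : G a ≤ c := by
  obtain ⟨k, hk, hkc⟩ := extraction_of_frequently_atTop hc
  exact h.closed _ a c (hx.comp hk.tendsto_atTop) hkc

theorem SeqLowerSemicontinuous.le_of_frequently (hF : SeqLowerSemicontinuous F) {x : ℕ → X} {a : X}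
    (hx : Tendsto x atTop (𝓝 a)) {c : ENNReal} (hc : ∃ᶠ n in atTop, F (x n) ≤ c) : F a ≤ c :=
  (hF x a hx).trans (liminf_le_of_frequently_le' hc)

/-- The penalized functionals have sequentially closed sublevels. -/
theorem CoerciveConstraint.penalized_le (h : CoerciveConstraint F G)
    (hF : SeqLowerSemicontinuous F) {ε : ℝ} (hε : 0 < ε) {x : ℕ → X} {a : X}
    (hx : Tendsto x atTop (𝓝 a)) {c : ℝ} (hc : ∀ n, penalized F G ε (x n) ≤ c) :
    penalized F G ε a ≤ c := by
  choose f g hf hg hFf hGg hE using fun n =>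
    exists_real_of_penalized_lt_top h.nonneg hε ((hc n).trans_lt (EReal.coe_lt_top _))
  have hle : ∀ n, f n + ε⁻¹ * g n ≤ c := fun n => by
    have := hc n
    rw [hE] at this
    exact EReal.coe_le_coe_iff.1 this
  have hgle : ∀ n (s : ℝ), s ≤ f n → g n ≤ ε * (c - s) := fun n s hs => by
    have h1 : ε⁻¹ * g n ≤ c - s := by linarith [hle n]
    calc g n = ε * (ε⁻¹ * g n) := by field_simp
      _ ≤ ε * (c - s) := by gcongr
  have hFa : F a ≤ ENNReal.ofReal c := by
    refine hF.le_of_frequently hx (Frequently.of_forall fun n => ?_)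
    rw [hFf]
    refine ENNReal.ofReal_le_ofReal ?_
    have : 0 ≤ ε⁻¹ * g n := mul_nonneg (inv_nonneg.2 hε.le) (hg n)
    linarith [hle n]
  have hFt : F a ≠ ⊤ := (hFa.trans_lt ENNReal.ofReal_lt_top).ne
  set r := (F a).toReal
  have hFr : F a = ENNReal.ofReal r := (ENNReal.ofReal_toReal hFt).symm
  -- Semicontinuity of `F` gives `f n ≥ r - δ` frequently; the energy bound then leaves at most `ε
  -- (c - (r - δ))` for `G`, and this sublevel is closed.
  have key : ∀ δ : ℝ, 0 < δ → G a ≤ ((ε * (c - (r - δ)) : ℝ) : EReal) := by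
    intro δ hδ
    refine h.le_of_frequently hx ?_
    have hfr : ∃ᶠ n in atTop, r - δ ≤ f n := by
      rw [Filter.Frequently]
      intro hev
      have h1 : F a ≤ ENNReal.ofReal (r - δ) := by
        refine hF.le_of_frequently hx (Eventually.frequently (hev.mono fun n hn => ?_))
        rw [hFf]
        exact ENNReal.ofReal_le_ofReal (not_le.1 hn).le
      obtain ⟨n, hn⟩ := hev.exists
      rw [hFr, ENNReal.ofReal_le_ofReal_iff ((hf n).trans (not_le.1 hn).le)] at h1
      linarith
    refine hfr.mono fun n hn => ?_
    rw [hGg]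
    exact EReal.coe_le_coe_iff.2 (hgle n _ hn)
  obtain ⟨q, hq⟩ := exists_real_of_ne (ne_bot_of_le_ne_bot EReal.zero_ne_bot (h.nonneg a))
    ((key 1 one_pos).trans_lt (EReal.coe_lt_top _)).ne
  rw [penalized, hq, ← coe_toReal_ennreal hFt, ← EReal.coe_mul, ← EReal.coe_add,
    EReal.coe_le_coe_iff]
  refine le_of_forall_pos_le_add fun δ hδ => ?_
  have h2 := key δ hδ
  rw [hq, EReal.coe_le_coe_iff] at h2
  have h3 : ε⁻¹ * q ≤ c - (r - δ) := by
    calc ε⁻¹ * q ≤ ε⁻¹ * (ε * (c - (r - δ))) := by gcongr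
      _ = _ := by field_simp
  linarith

/-- The direct method: along a minimizing sequence `F` is finite and `G ≤ ε (m + 1)`. If the
functional is identically `∞`, any point minimizes. -/
theorem CoerciveConstraint.exists_minimizer [Nonempty X] (h : CoerciveConstraint F G)
    (hF : SeqLowerSemicontinuous F) {ε : ℝ} (hε : 0 < ε) :
    ∃ x, IsMinimizer (penalized F G ε) x := by
  by_cases htop : ⨅ x, penalized F G ε x = ⊤
  · obtain ⟨x⟩ := ‹Nonempty X›
    exact ⟨x, fun z => by rw [iInf_eq_top.1 htop z]; exact le_top⟩
  have h0 : 0 ≤ ⨅ x, penalized F G ε x := le_iInf (penalized_nonneg h.nonneg hε)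
  obtain ⟨m, hm⟩ := exists_real_of_ne (ne_bot_of_le_ne_bot EReal.zero_ne_bot h0) htop
  have hex : ∀ n : ℕ, ∃ x, penalized F G ε x < ((m + 1 / ((n : ℝ) + 1) : ℝ) : EReal) := fun n => by
    refine iInf_lt_iff.1 ?_
    rw [hm, EReal.coe_lt_coe_iff]
    have : (0 : ℝ) < 1 / ((n : ℝ) + 1) := by positivity
    linarith
  choose x hx using hex
  have hone : ∀ n : ℕ, 1 / ((n : ℝ) + 1) ≤ 1 := fun n => by
    rw [div_le_one (by positivity)]
    have : (0 : ℝ) ≤ n := n.cast_nonneg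
    linarith
  choose f g hf hg hFf hGg hE using fun n =>
    exists_real_of_penalized_lt_top h.nonneg hε ((hx n).trans (EReal.coe_lt_top _))
  obtain ⟨k, a, hk, ha⟩ := h.compact x (ε * (m + 1))
    (fun n => by rw [hFf]; exact ENNReal.ofReal_lt_top) (fun n => by
      have h1 := hx n
      rw [hE, EReal.coe_lt_coe_iff] at h1
      rw [hGg, EReal.coe_le_coe_iff]
      calc g n = ε * (ε⁻¹ * g n) := by field_simp
        _ ≤ ε * (m + 1) := by
          have := hone n
          have := hf n
          gcongr
          linarith)
  refine ⟨a, fun z => le_trans ?_ (iInf_le _ z)⟩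
  rw [hm]
  refine EReal.le_of_forall_lt_iff_le.1 fun c hc => ?_
  have hc' : m < c := EReal.coe_lt_coe_iff.1 hc
  obtain ⟨N, hN⟩ := exists_nat_one_div_lt (sub_pos.2 hc')
  refine h.penalized_le hF hε (x := fun n => x (k (n + N))) (ha.comp (tendsto_add_atTop_nat N))
    fun n => (hx _).le.trans (EReal.coe_le_coe_iff.2 ?_)
  have h1 : N ≤ k (n + N) := (Nat.le_add_left N n).trans (hk.le_apply)
  have h2 : 1 / ((k (n + N) : ℝ) + 1) ≤ 1 / ((N : ℝ) + 1) :=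
    one_div_le_one_div_of_le (by positivity) (by gcongr)
  linarith

/-- The lower bound in the Γ-convergence of the penalized functionals. -/
theorem CoerciveConstraint.constrained_le_liminf (h : CoerciveConstraint F G)
    (hF : SeqLowerSemicontinuous F) {ε : ℕ → ℝ} (hε : IsVanishing ε) {x : ℕ → X} {a : X}
    (hx : Tendsto x atTop (𝓝 a)) :
    constrained F G a ≤ liminf (fun n => penalized F G (ε n) (x n)) atTop := by
  refine EReal.le_of_forall_lt_iff_le.1 fun c hc => ?_
  obtain ⟨k, hk, hkc⟩ := extraction_of_frequently_atTop
    (frequently_lt_of_liminf_lt (by isBoundedDefault) hc)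
  choose f g hf hg hFf hGg hE using fun n =>
    exists_real_of_penalized_lt_top h.nonneg (hε.1 (k n)) ((hkc n).trans (EReal.coe_lt_top _))
  have hle : ∀ n, f n + (ε (k n))⁻¹ * g n ≤ c := fun n => by
    have := hkc n
    rw [hE, EReal.coe_lt_coe_iff] at this
    exact this.le
  have hxk := hx.comp hk.tendsto_atTop
  -- Bounded energy gives `g n ≤ ε (k n) * c`, which tends to `0`.
  have hG0 : G a = 0 := by
    refine le_antisymm (EReal.le_of_forall_lt_iff_le.1 fun δ hδ => ?_) (h.nonneg a)
    have hδ' : 0 < δ := EReal.coe_pos.1 hδ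
    refine h.le_of_frequently hxk (Eventually.frequently ?_)
    have hlim : Tendsto (fun n => ε (k n) * c) atTop (𝓝 0) := by
      simpa using (hε.2.comp hk.tendsto_atTop).mul_const c
    filter_upwards [hlim.eventually_lt_const hδ'] with n hn
    rw [Function.comp_apply, hGg, EReal.coe_le_coe_iff]
    have hpos := hε.1 (k n)
    calc g n = ε (k n) * ((ε (k n))⁻¹ * g n) := by field_simp
      _ ≤ ε (k n) * c := by
        have := hle n
        have := hf n
        gcongr
        linarith
      _ ≤ δ := hn.le
  have hc0 : 0 ≤ c := by
    have : 0 ≤ (ε (k 0))⁻¹ * g 0 := mul_nonneg (inv_nonneg.2 (hε.1 _).le) (hg 0)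
    linarith [hle 0, hf 0]
  rw [constrained, if_pos hG0]
  have hFa : F a ≤ ENNReal.ofReal c := by
    refine hF.le_of_frequently hxk (Frequently.of_forall fun n => ?_)
    rw [Function.comp_apply, hFf]
    refine ENNReal.ofReal_le_ofReal ?_
    have : 0 ≤ (ε (k n))⁻¹ * g n := mul_nonneg (inv_nonneg.2 (hε.1 _).le) (hg n)
    linarith [hle n]
  calc (F a : EReal) ≤ (ENNReal.ofReal c : EReal) := EReal.coe_ennreal_le_coe_ennreal_iff.2 hFa
    _ = c := by rw [EReal.coe_ennreal_ofReal, max_eq_left hc0]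

theorem CoerciveConstraint.gammaConverges (h : CoerciveConstraint F G)
    (hF : SeqLowerSemicontinuous F) : GammaConverges (penalized F G) (constrained F G) :=
  fun _ hε => ⟨fun _ _ hx => h.constrained_le_liminf hF hε hx,
    fun a => ⟨fun _ => a, tendsto_const_nhds, tendsto_penalized h.nonneg hε a⟩⟩

/-- Quasiminimizers of the penalized functionals converge along subsequences to minimizers of the
limit. -/
theorem CoerciveConstraint.exists_subseq_of_isQuasimin (h : CoerciveConstraint F G)
    (hF : SeqLowerSemicontinuous F) {ε : ℕ → ℝ} (hε : IsVanishing ε) {x : ℕ → X}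
    (hx : IsQuasimin (penalized F G) ε x) :
    ∃ (k : ℕ → ℕ) (a : X), StrictMono k ∧ Tendsto (fun n => x (k n)) atTop (𝓝 a) ∧
      IsMinimizer (constrained F G) a := by
  have hI0 : ∀ n, 0 ≤ ⨅ z, penalized F G (ε n) z := fun n =>
    le_iInf (penalized_nonneg h.nonneg (hε.1 n))
  -- If the energy were `∞`, its difference with the infimum would be `∞` or, for an infinite
  -- infimum, `-∞`; closeness to `0` excludes both.
  have hfin : ∀ᶠ n in atTop, penalized F G (ε n) (x n) < ⊤ := by
    filter_upwards [hx.eventually_lt_const (u := 1) (by norm_num),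
      hx.eventually_const_lt (u := ⊥) (by simp)] with n h1 h2
    refine lt_top_iff_ne_top.2 fun htop => ?_
    rw [htop] at h1 h2
    by_cases hI : ⨅ z, penalized F G (ε n) z = ⊤
    · rw [hI, EReal.sub_top] at h2
      exact lt_irrefl _ h2
    · obtain ⟨i, hi⟩ := exists_real_of_ne (ne_bot_of_le_ne_bot EReal.zero_ne_bot (hI0 n)) hI
      rw [hi, EReal.top_sub_coe] at h1
      exact not_top_lt h1
  have hquasi : ∀ δ : ℝ, 0 < δ → ∀ᶠ n in atTop, ∀ (z : X) (c : ℝ),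
      penalized F G (ε n) z ≤ c → penalized F G (ε n) (x n) ≤ ((c + δ : ℝ) : EReal) := by
    intro δ hδ
    filter_upwards [hx.eventually_lt_const (u := (δ : EReal)) (EReal.coe_pos.2 hδ), hfin]
      with n h1 h2 z c hz
    obtain ⟨e, he⟩ := exists_real_of_ne (ne_bot_of_le_ne_bot EReal.zero_ne_bot
      (penalized_nonneg h.nonneg (hε.1 n) (x n))) h2.ne
    obtain ⟨i, hi⟩ := exists_real_of_ne (ne_bot_of_le_ne_bot EReal.zero_ne_bot (hI0 n))
      (((iInf_le _ z).trans hz).trans_lt (EReal.coe_lt_top _)).ne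
    have h3 := (iInf_le _ z).trans hz
    rw [hi, EReal.coe_le_coe_iff] at h3
    rw [he, hi, ← EReal.coe_sub, EReal.coe_lt_coe_iff] at h1
    rw [he, EReal.coe_le_coe_iff]
    linarith
  obtain ⟨N, hN⟩ := eventually_atTop.1 (hfin.and (hquasi 1 one_pos))
  -- `x N` is a fixed competitor with energy `f₀ + g₀ / ε n`. Quasiminimality up to `1` and
  -- multiplication by `ε n` give `G ≤ ε n (f₀ + 1) + g₀`, bounded uniformly in `n`.
  obtain ⟨f₀, g₀, hf₀, hg₀, hF₀, hG₀, -⟩ :=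
    exists_real_of_penalized_lt_top h.nonneg (hε.1 N) (hN N le_rfl).1
  obtain ⟨B, hB⟩ := exists_norm_le_of_tendsto hε.2
  have hbound : ∀ n, F (x (n + N)) < ⊤ ∧ G (x (n + N)) ≤ ((B * (f₀ + 1) + g₀ : ℝ) : EReal) := by
    intro n
    obtain ⟨h1, h2⟩ := hN (n + N) (Nat.le_add_left N n)
    obtain ⟨f, g, hf, hg, hFf, hGg, hE⟩ :=
      exists_real_of_penalized_lt_top h.nonneg (hε.1 (n + N)) h1
    refine ⟨by rw [hFf]; exact ENNReal.ofReal_lt_top, ?_⟩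
    have h3 : penalized F G (ε (n + N)) (x N) = ((f₀ + (ε (n + N))⁻¹ * g₀ : ℝ) : EReal) := by
      rw [penalized, hG₀, hF₀, EReal.coe_ennreal_ofReal, max_eq_left hf₀, EReal.coe_add,
        EReal.coe_mul]
    have h4 := h2 (x N) _ h3.le
    rw [hE, EReal.coe_le_coe_iff] at h4
    rw [hGg, EReal.coe_le_coe_iff]
    have hpos := hε.1 (n + N)
    have h5 : ε (n + N) ≤ B := (le_abs_self _).trans (hB _)
    calc g = ε (n + N) * ((ε (n + N))⁻¹ * g) := by field_simp
      _ ≤ ε (n + N) * (f₀ + 1 + (ε (n + N))⁻¹ * g₀) := by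
        gcongr
        linarith
      _ = ε (n + N) * (f₀ + 1) + g₀ := by field_simp
      _ ≤ B * (f₀ + 1) + g₀ := by gcongr
  obtain ⟨k, a, hk, ha⟩ := h.compact (fun n => x (n + N)) _ (fun n => (hbound n).1)
    fun n => (hbound n).2
  have hk' : StrictMono fun n => k n + N := fun i j hij => by
    have := hk hij
    dsimp only
    omega
  refine ⟨fun n => k n + N, a, hk', ha, fun z => ?_⟩
  -- Only zeros of `G` compete; there the penalized energy equals `F z` for every `ε`, and the lower
  -- bound compares it with the limit point.
  by_cases hz : G z = 0
  · rw [show constrained F G z = (F z : EReal) from if_pos hz]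
    refine (h.constrained_le_liminf hF (hε.comp hk'.tendsto_atTop) ha).trans ?_
    by_cases hFz : F z = ⊤
    · rw [hFz, EReal.coe_ennreal_top]; exact le_top
    rw [← coe_toReal_ennreal hFz]
    refine EReal.le_of_forall_lt_iff_le.1 fun c hc => ?_
    have hc' := sub_pos.2 (EReal.coe_lt_coe_iff.1 hc)
    refine liminf_le_of_frequently_le' (Eventually.frequently ?_)
    filter_upwards [hk'.tendsto_atTop.eventually (hquasi _ hc')] with n hn
    have h1 := hn z (F z).toReal (by
      rw [penalized_eq_of_eq_zero hz, coe_toReal_ennreal hFz])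
    rwa [add_sub_cancel] at h1
  · rw [show constrained F G z = ⊤ from if_neg hz]
    exact le_top

/-- Every subsequence is again quasiminimizing, so it has a further subsequence converging to a
minimizer, necessarily `a`. -/
theorem CoerciveConstraint.tendsto_of_isQuasimin (h : CoerciveConstraint F G)
    (hF : SeqLowerSemicontinuous F) {a : X}
    (hunique : ∀ b, IsMinimizer (constrained F G) b → b = a) {ε : ℕ → ℝ} (hε : IsVanishing ε)
    {x : ℕ → X} (hx : IsQuasimin (penalized F G) ε x) : Tendsto x atTop (𝓝 a) := by
  refine tendsto_of_subseq_tendsto fun ns hns => ?_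
  obtain ⟨k, b, -, hb, hmin⟩ := h.exists_subseq_of_isQuasimin hF (hε.comp hns)
    (x := fun n => x (ns n)) (Tendsto.comp hx hns)
  exact ⟨k, hunique b hmin ▸ hb⟩

end Penalization

end DeGiorgi

end

/-! ### The De Giorgi functional as a coercive constraint. -/

theorem theorem4p1 {H : Type*} [NormedAddCommGroup H] [InnerProductSpace ℝ H] [CompleteSpace H]
    [TopologicalSpace.SeparableSpace H]
    (T : ℝ) (hT : 0 < T)
    (φ φ₁ : H → EReal) (φ₂ : H → ℝ) (hφ : ∀ x, φ x = φ₁ x + (φ₂ x : EReal))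
    (hsub : ∀ c : ℝ, IsCompact {x | φ x ≤ (c : EReal)})
    (hchain : DeGiorgi.ChainRule T φ)
    (hproper : DeGiorgi.IsProper φ₁) (hconvex : DeGiorgi.IsConvex φ₁)
    (hlsc : LowerSemicontinuous φ₁)
    (hsingle : ∀ y, (DeGiorgi.convexSubdiff φ₁ y).Subsingleton)
    (hC11 : DeGiorgi.IsC11 φ₂)
    (y₀ : H) (hy₀ : φ y₀ < ⊤)
    (U : Set (DeGiorgi.L2 T H)) (hUne : U.Nonempty) (hU : IsCompact U)
    (F : DeGiorgi.PhaseSpace T H → ENNReal) (hF : DeGiorgi.SeqLowerSemicontinuous F)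
    (hFU : ∀ x, F x < ⊤ → x.1 ∈ U)
    (G : DeGiorgi.PhaseSpace T H → EReal) (hG : G = DeGiorgi.constraint T φ y₀)
    (E : ℝ → DeGiorgi.PhaseSpace T H → EReal) (hE : E = DeGiorgi.penalized F G)
    (E₀ : DeGiorgi.PhaseSpace T H → EReal) (hE₀ : E₀ = DeGiorgi.constrained F G) :
    -- the De Giorgi functional takes values in `[0,∞]`
    (∀ x, 0 ≤ G x) ∧
    -- existence of minimizers
    (∀ ε : ℝ, 0 < ε → ∃ x, DeGiorgi.IsMinimizer (E ε) x) ∧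
    -- Γ-convergence
    DeGiorgi.GammaConverges E E₀ ∧
    -- quasiminimizers converge up to subsequences to minimizers of the limit
    (∀ (ε : ℕ → ℝ) (x : ℕ → DeGiorgi.PhaseSpace T H), DeGiorgi.IsVanishing ε →
      DeGiorgi.IsLiminfQuasimin E ε x →
      ∃ (k : ℕ → ℕ) (a : DeGiorgi.PhaseSpace T H), StrictMono k ∧
        Tendsto (fun n => x (k n)) atTop (𝓝 a) ∧ DeGiorgi.IsMinimizer E₀ a) ∧
    -- if the limit has a unique minimizer, the whole sequence converges to it
    (∀ a : DeGiorgi.PhaseSpace T H, DeGiorgi.IsMinimizer E₀ a →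
      (∀ b, DeGiorgi.IsMinimizer E₀ b → b = a) →
      ∀ (ε : ℕ → ℝ) (x : ℕ → DeGiorgi.PhaseSpace T H), DeGiorgi.IsVanishing ε →
        DeGiorgi.IsQuasimin E ε x → Tendsto x atTop (𝓝 a)) := by
  have hbot : ∀ x, φ x ≠ ⊥ := fun x => by
    rw [hφ]
    exact EReal.add_ne_bot_iff.2 ⟨hproper.1 x, EReal.coe_ne_bot _⟩
  have hcs := DeGiorgi.closedSingleSubdiff hφ hproper hconvex hlsc hsingle hC11.1
  have hcc : DeGiorgi.CoerciveConstraint F G := by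
    subst hG
    exact
      { nonneg := fun x => hcs.GDG_nonneg hT.le hbot hchain hy₀ _ _
        closed := fun x a c hx hc => hcs.constraint_lsc hT hbot hsub hchain hy₀ hx hc
        compact := fun x c hFx hc =>
          hcs.constraint_compact hT hbot hsub hchain hy₀ hU (fun n => hFU _ (hFx n)) hc }
  subst hE hE₀
  refine ⟨hcc.nonneg, fun ε hε => hcc.exists_minimizer hF hε, hcc.gammaConverges hF, ?_, ?_⟩
  · intro ε x hε hx
    obtain ⟨k, hk, hq⟩ := DeGiorgi.exists_isQuasimin_subseq hx
    obtain ⟨l, a, hl, ha, hmin⟩ :=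
      hcc.exists_subseq_of_isQuasimin hF (hε.comp hk.tendsto_atTop) hq
    exact ⟨k ∘ l, a, hk.comp hl, ha, hmin⟩
  · intro a _ hunique ε x hε hx
    exact hcc.tendsto_of_isQuasimin hF hunique hε hx
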